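/- Let $(M,g)$ be a smooth compact Riemannian manifold without boundary, with Laplace–Beltrami operator $\Delta$ and Riemannian volume $dx_g$; all norms $\|\cdot\|$ of functions and gradients are those of $L^2(M,dx_g)$. There are constants $C_p>0$ such that $$\|f\|\le C_p\|\nabla f\|\quad\text{for all } f\in H^1(M) \text{ orthogonal to } \ker\Delta ,$$ and for every such constant $C_p$ the following holds. Let $W\colon M\times\mathbb R\to[0,\infty)$ be such that $W$ and $\partial_tW$ exist everywhere and are bounded and continuous on $M\times\mathbb R$, and put $B_1=\max(3,\|W\|_{L^\infty}^2)$. Let $u\in C^0(\mathbb R;H^1(M))\cap C^1(\mathbb R;L^2(M))$ be a (weak, complex-valued) solution of $$(\partial_t^2-\Delta+W(x,t)\partial_t)u=0$$ whose initial data $(u,u_t)|_{t=0}\in H^1(M)\oplus L^2(M)$ are orthogonal to $\ker\Delta\times\{0\}$, and let $E(t)=\frac12\left(\|\nabla u(t)\|^2+\|u_t(t)\|^2\right)$ be its energy. Then for all real $t_1,t_2$ with $t_2-t_1>2$ and all $0<\varepsilon<\frac12$, $$\frac{\varepsilon}{2B_1}(t_2-t_1-2)\,E(t_2)-\frac{C_p^2\varepsilon^2}{2B_1}(t_2-t_1)\,E(t_1)\le\int_{t_1}^{t_2}\|u_t(t)\|^2\,dt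 .$$ -/

import Mathlib

open MeasureTheory Bundle Manifold UniformSpace
open scoped ContDiff ComplexConjugate BoundedContinuousFunction

noncomputable section

namespace DampedWave

/-! ### Covectors -/

/-- The Hermitian inner product induced by a Euclidean inner product on `T` on complex-valued
covectors, `⟨α, β⟩ = ∑ᵢ conj (α eᵢ) * β eᵢ` for an orthonormal basis `e` of `T`. In particular
`⟨df, df⟩` is `|∇ f|²`, that is `|∇ Re f|² + |∇ Im f|²`. -/
def covectorInner {T : Type*} [NormedAddCommGroup T] [InnerProductSpace ℝ T]
    [FiniteDimensional ℝ T] (α β : T →L[ℝ] ℂ) : ℂ :=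
  ∑ i, conj (α (stdOrthonormalBasis ℝ T i)) * β (stdOrthonormalBasis ℝ T i)

/-- The inner product of covectors in terms of an arbitrary basis: its matrix is the inverse of
the Gram matrix. -/
theorem covectorInner_eq_gram {T : Type*} [NormedAddCommGroup T] [InnerProductSpace ℝ T]
    [FiniteDimensional ℝ T] {ι : Type*} [Fintype ι] [DecidableEq ι] (s : Module.Basis ι ℝ T)
    (α β : T →L[ℝ] ℂ) :
    IsUnit (Matrix.of fun i j => inner ℝ (s i) (s j)).det ∧
    covectorInner α β = ∑ i, ∑ j, conj (α (s i)) *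
      (((Matrix.of fun i j => inner ℝ (s i) (s j))⁻¹ i j : ℝ) : ℂ) * β (s j) := by
  set e := stdOrthonormalBasis ℝ T with he
  set Q : Matrix _ _ ℝ := s.toMatrix e with hQ
  set P : Matrix _ _ ℝ := e.toBasis.toMatrix s with hP
  have hPQ : P * Q = 1 := by
    rw [hP, hQ, ← e.coe_toBasis]; exact Module.Basis.toMatrix_mul_toMatrix_flip _ _
  have hQP : Q * P = 1 := by
    rw [hP, hQ, ← e.coe_toBasis]; exact Module.Basis.toMatrix_mul_toMatrix_flip _ _
  have hG : (Matrix.of fun i j => inner ℝ (s i) (s j)) = P.transpose * P := by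
    ext i j
    simp only [Matrix.of_apply, Matrix.mul_apply, Matrix.transpose_apply, hP,
      Module.Basis.toMatrix_apply, OrthonormalBasis.coe_toBasis_repr_apply,
      OrthonormalBasis.repr_apply_apply]
    rw [← e.sum_inner_mul_inner (s i) (s j)]
    simp only [real_inner_comm]
  have hmul : P.transpose * P * (Q * Q.transpose) = 1 := by
    calc P.transpose * P * (Q * Q.transpose) = P.transpose * (P * Q) * Q.transpose := by
          simp only [Matrix.mul_assoc]
      _ = 1 := by rw [hPQ, Matrix.mul_one, ← Matrix.transpose_mul, hQP, Matrix.transpose_one]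
  have hinv : (Matrix.of fun i j => inner ℝ (s i) (s j))⁻¹ = Q * Q.transpose := by
    rw [hG]; exact Matrix.inv_eq_right_inv hmul
  refine ⟨?_, ?_⟩
  · rw [hG]; exact (Matrix.isUnit_iff_isUnit_det _).1 (IsUnit.of_mul_eq_one _ hmul)
  rw [hinv, covectorInner]
  have hexp : ∀ (γ : T →L[ℝ] ℂ) k, γ (e k) = ∑ i, (Q i k : ℂ) * γ (s i) := by
    intro γ k
    conv_lhs => rw [← s.sum_repr (e k), map_sum]
    simp only [map_smul, hQ, Module.Basis.toMatrix_apply, Complex.real_smul]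
  simp only [← he, hexp, Matrix.mul_apply, Matrix.transpose_apply, map_sum, map_mul,
    Complex.conj_ofReal, Complex.ofReal_sum, Complex.ofReal_mul]
  simp only [Finset.sum_mul, Finset.mul_sum]
  rw [Finset.sum_comm]
  refine Eq.trans (Finset.sum_congr rfl fun i _ => Finset.sum_comm) ?_
  rw [Finset.sum_comm]
  refine Finset.sum_congr rfl fun i _ => Finset.sum_congr rfl fun j _ =>
    Finset.sum_congr rfl fun k _ => ?_
  ring

theorem covectorInner_add_left {T : Type*} [NormedAddCommGroup T] [InnerProductSpace ℝ T]
    [FiniteDimensional ℝ T] (α α' β : T →L[ℝ] ℂ) :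
    covectorInner (α + α') β = covectorInner α β + covectorInner α' β := by
  simp [covectorInner, add_mul, Finset.sum_add_distrib]

theorem covectorInner_add_right {T : Type*} [NormedAddCommGroup T] [InnerProductSpace ℝ T]
    [FiniteDimensional ℝ T] (α β β' : T →L[ℝ] ℂ) :
    covectorInner α (β + β') = covectorInner α β + covectorInner α β' := by
  simp [covectorInner, mul_add, Finset.sum_add_distrib]

theorem covectorInner_conj_symm {T : Type*} [NormedAddCommGroup T] [InnerProductSpace ℝ T]
    [FiniteDimensional ℝ T] (α β : T →L[ℝ] ℂ) :
    conj (covectorInner α β) = covectorInner β α := by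
  simp [covectorInner, mul_comm]

theorem covectorInner_self {T : Type*} [NormedAddCommGroup T] [InnerProductSpace ℝ T]
    [FiniteDimensional ℝ T] (α : T →L[ℝ] ℂ) :
    covectorInner α α = ((∑ i, ‖α (stdOrthonormalBasis ℝ T i)‖ ^ 2 : ℝ) : ℂ) := by
  simp [covectorInner, Complex.conj_mul']

theorem norm_covectorInner_le {T : Type*} [NormedAddCommGroup T] [InnerProductSpace ℝ T]
    [FiniteDimensional ℝ T] (α β : T →L[ℝ] ℂ) :
    ‖covectorInner α β‖ ≤ ‖covectorInner α α‖ + ‖covectorInner β β‖ := by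
  rw [covectorInner_self α, covectorInner_self β, Complex.norm_real, Complex.norm_real,
    Real.norm_of_nonneg (by positivity), Real.norm_of_nonneg (by positivity),
    ← Finset.sum_add_distrib]
  refine (norm_sum_le _ _).trans (Finset.sum_le_sum fun i _ => ?_)
  rw [norm_mul, RCLike.norm_conj]
  nlinarith [sq_nonneg (‖α (stdOrthonormalBasis ℝ T i)‖ - ‖β (stdOrthonormalBasis ℝ T i)‖),
    sq_nonneg ‖α (stdOrthonormalBasis ℝ T i)‖, sq_nonneg ‖β (stdOrthonormalBasis ℝ T i)‖]

instance (n : ℕ) {M : Type*} [TopologicalSpace M]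
    [ChartedSpace (EuclideanSpace ℝ (Fin n)) M] (x : M) :
    FiniteDimensional ℝ (TangentSpace (𝓡 n) x) :=
  inferInstanceAs (FiniteDimensional ℝ (EuclideanSpace ℝ (Fin n)))

section Differential

/-! ### The differential of a smooth function -/

variable (n : ℕ) {M : Type*} [TopologicalSpace M] [ChartedSpace (EuclideanSpace ℝ (Fin n)) M]

/-- The differential of a complex-valued function, as a complex-valued covector field. -/
abbrev differential (f : M → ℂ) (x : M) : TangentSpace (𝓡 n) x →L[ℝ] ℂ :=
  mfderiv (𝓡 n) 𝓘(ℝ, ℂ) f x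

variable {n}

theorem differential_add {f h : M → ℂ} (hf : ContMDiff (𝓡 n) 𝓘(ℝ, ℂ) ∞ f)
    (hh : ContMDiff (𝓡 n) 𝓘(ℝ, ℂ) ∞ h) (x : M) :
    differential n (f + h) x = differential n f x + differential n h x :=
  mfderiv_add (hf.mdifferentiableAt (by simp)) (hh.mdifferentiableAt (by simp))

theorem differential_smul {f : M → ℂ} (hf : ContMDiff (𝓡 n) 𝓘(ℝ, ℂ) ∞ f) (a : ℂ) (x : M)
    (v : TangentSpace (𝓡 n) x) : differential n (a • f) x v = a * differential n f x v := by
  have h1 : HasMFDerivAt (𝓡 n) 𝓘(ℝ, ℂ) f x (differential n f x) :=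
    (hf.mdifferentiableAt (by simp)).hasMFDerivAt
  have h2 := (ContinuousLinearMap.mul ℝ ℂ a).hasMFDerivAt (x := f x)
  have h3 := (h2.comp x h1).mfderiv
  have h4 : (ContinuousLinearMap.mul ℝ ℂ a) ∘ f = a • f := rfl
  rw [h4] at h3
  rw [differential, h3]
  rfl

end Differential

section Manifold

variable (n : ℕ) (M : Type*) [TopologicalSpace M] [ChartedSpace (EuclideanSpace ℝ (Fin n)) M]
  [RiemannianBundle (fun x : M => TangentSpace (𝓡 n) x)]

/-! ### The Riemannian volume measure -/

variable {M} in
/-- The matrix `g_ij = g(∂_i, ∂_j)` of the metric in the chart at `c`, at the point `y` of the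
target of this chart. -/
def chartMetric (c : M) (y : EuclideanSpace ℝ (Fin n)) : Matrix (Fin n) (Fin n) ℝ :=
  let ψ := (chartAt (EuclideanSpace ℝ (Fin n)) c).symm
  let del : Fin n → TangentSpace (𝓡 n) (ψ y) := fun i =>
    mfderiv (𝓡 n) (𝓡 n) ψ y (EuclideanSpace.single i (1 : ℝ))
  Matrix.of fun i j => inner ℝ (del i) (del j)

variable {M} in
/-- The measure `√(det g_ij) dy` on the domain of the chart at `c`, as a measure on `M`. -/
def chartVolume [MeasurableSpace M] (c : M) : Measure M :=
  ((volume.restrict (chartAt (EuclideanSpace ℝ (Fin n)) c).target).withDensity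
    fun y => ENNReal.ofReal √(chartMetric n c y).det).map
      (chartAt (EuclideanSpace ℝ (Fin n)) c).symm

/-- The Riemannian volume measure `dx_g`. The measures `chartVolume n c` agree on the overlaps of
the chart domains, so their supremum is the measure on `M` which restricts to `chartVolume n c`
on the domain of the chart at `c`, for every `c`. -/
def riemannianVolume [MeasurableSpace M] : Measure M :=
  ⨆ c : M, chartVolume n c

/-- The complex Hilbert space `L²(M)`. -/
abbrev L2 [MeasurableSpace M] : Type _ := Lp ℂ 2 (riemannianVolume n M)

variable [IsManifold (𝓡 n) ∞ M]
  [IsContMDiffRiemannianBundle (𝓡 n) ∞ (EuclideanSpace ℝ (Fin n))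
    (fun x : M => TangentSpace (𝓡 n) x)]

variable {n M} in
theorem continuous_covectorInner_differential {f h : M → ℂ} (hf : ContMDiff (𝓡 n) 𝓘(ℝ, ℂ) ∞ f)
    (hh : ContMDiff (𝓡 n) 𝓘(ℝ, ℂ) ∞ h) :
    Continuous fun x => covectorInner (differential (n := n) f x)
      (differential (n := n) h x) := by
  have : IsManifold (𝓡 n) 1 M := IsManifold.of_le (n := ∞) (by norm_cast)
  have : IsContMDiffRiemannianBundle (𝓡 n) 1 (EuclideanSpace ℝ (Fin n)) (fun x : M => TangentSpace (𝓡 n) x) :=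
    IsContMDiffRiemannianBundle.of_le (n := ∞) (by norm_cast)
  have : IsContinuousRiemannianBundle (EuclideanSpace ℝ (Fin n))
      (fun x : M => TangentSpace (𝓡 n) x) := by
    obtain ⟨g, hg, hg'⟩ := IsContMDiffRiemannianBundle.exists_contMDiff (IB := 𝓡 n) (n := ∞)
      (F := EuclideanSpace ℝ (Fin n)) (E := fun x : M => TangentSpace (𝓡 n) x)
    exact ⟨g, hg.continuous, hg'⟩
  rw [continuous_iff_continuousAt]
  intro x₀
  let e := trivializationAt (EuclideanSpace ℝ (Fin n)) (fun x : M => TangentSpace (𝓡 n) x) x₀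
  let b := (EuclideanSpace.basisFun (Fin n) ℝ).toBasis
  have hfr := e.isLocalFrameOn_localFrame_baseSet (𝓡 n) (n := 1) b
  have hx₀ : x₀ ∈ e.baseSet := FiberBundle.mem_baseSet_trivializationAt' x₀
  have hs : ∀ i, ContinuousOn (fun x => (⟨x, e.localFrame b i x⟩ :
      TotalSpace (EuclideanSpace ℝ (Fin n)) (fun x : M => TangentSpace (𝓡 n) x))) e.baseSet :=
    fun i => (hfr.contMDiffOn i).continuousOn
  have hd : ∀ {k : M → ℂ}, ContMDiff (𝓡 n) 𝓘(ℝ, ℂ) ∞ k → ∀ i,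
      ContinuousOn (fun x => (differential (n := n) k x (e.localFrame b i x))) e.baseSet := by
    intro k hk i
    have h1 : Continuous (tangentMap (𝓡 n) 𝓘(ℝ, ℂ) k) :=
      hk.continuous_tangentMap (by simp)
    have h2 := h1.comp_continuousOn (hs i)
    have h3 := (contMDiff_snd_tangentBundle_modelSpace ℂ 𝓘(ℝ, ℂ) (n := 1)).continuous
    exact h3.comp_continuousOn h2
  have hG : ∀ i j, ContinuousOn (fun x => (inner ℝ (e.localFrame b i x) (e.localFrame b j x) : ℝ))
      e.baseSet := fun i j => (hs i).inner_bundle (hs j)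
  let G : M → Matrix (Fin n) (Fin n) ℝ := fun x =>
    Matrix.of fun i j => inner ℝ (e.localFrame b i x) (e.localFrame b j x)
  have hGc : ContinuousOn G e.baseSet :=
    continuousOn_pi.2 fun i => continuousOn_pi.2 fun j => hG i j
  have key : ∀ x ∈ e.baseSet, IsUnit (G x).det ∧
      covectorInner (differential (n := n) f x) (differential (n := n) h x) =
      ∑ i, ∑ j, conj (differential (n := n) f x (e.localFrame b i x)) *
        (((G x)⁻¹ i j : ℝ) : ℂ) * (differential (n := n) h x (e.localFrame b j x)) := by
    intro x hx
    have := covectorInner_eq_gram (hfr.toBasisAt hx) (differential (n := n) f x)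
      (differential (n := n) h x)
    simpa only [hfr.toBasisAt_coe] using this
  have hinv : ContinuousOn (fun x => (G x)⁻¹) e.baseSet := by
    have : (fun x => (G x)⁻¹) = fun x => (Ring.inverse (G x).det) • (G x).adjugate := by
      funext x; rfl
    intro x hx
    rw [this]
    have hdet : ContinuousWithinAt (fun x => (G x).det) e.baseSet x :=
      (continuous_id.matrix_det.comp_continuousOn hGc) x hx
    have hadj : ContinuousWithinAt (fun x => (G x).adjugate) e.baseSet x :=
      (continuous_id.matrix_adjugate.comp_continuousOn hGc) x hx
    simp only [Ring.inverse_eq_inv']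
    exact (hdet.inv₀ (key x hx).1.ne_zero).smul hadj
  have hcont : ContinuousOn (fun x => covectorInner (differential (n := n) f x)
      (differential (n := n) h x)) e.baseSet := by
    refine ContinuousOn.congr ?_ fun x hx => (key x hx).2
    refine continuousOn_finsetSum _ fun i _ => continuousOn_finsetSum _ fun j _ => ?_
    refine ((Complex.continuous_conj.comp_continuousOn (hd hf i)).mul ?_).mul (hd hh j)
    exact Complex.continuous_ofReal.comp_continuousOn
      (continuousOn_pi.1 (continuousOn_pi.1 hinv i) j)
  exact hcont.continuousAt (e.open_baseSet.mem_nhds hx₀)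

variable {n M} in
theorem integrable_covectorInner_differential [MeasurableSpace M] [BorelSpace M] {f h : M → ℂ}
    (hf : ContMDiff (𝓡 n) 𝓘(ℝ, ℂ) ∞ f) (hh : ContMDiff (𝓡 n) 𝓘(ℝ, ℂ) ∞ h)
    (hf' : Integrable (fun x => covectorInner (differential n f x) (differential n f x))
      (riemannianVolume n M))
    (hh' : Integrable (fun x => covectorInner (differential n h x) (differential n h x))
      (riemannianVolume n M)) :
    Integrable (fun x => covectorInner (differential n f x) (differential n h x))
      (riemannianVolume n M) := by
  refine (hf'.norm.add hh'.norm).mono'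
    (continuous_covectorInner_differential hf hh).aestronglyMeasurable ?_
  exact Filter.Eventually.of_forall fun x => norm_covectorInner_le _ _

/-! ### The Sobolev space `H¹(M)` -/

variable [MeasurableSpace M] [BorelSpace M]

/-- The smooth functions `f` on `M` such that `f` and `∇ f` are square integrable (if `M` is
compact, these are all the smooth functions). -/
def smoothSubmodule : Submodule ℂ (M → ℂ) where
  carrier := {f | ContMDiff (𝓡 n) 𝓘(ℝ, ℂ) ∞ f ∧ MemLp f 2 (riemannianVolume n M) ∧
    Integrable (fun x => covectorInner (differential n f x) (differential n f x))
      (riemannianVolume n M)}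
  add_mem' := by
    rintro f h ⟨hf, hf2, hf3⟩ ⟨hh, hh2, hh3⟩
    refine ⟨hf.add hh, hf2.add hh2, ?_⟩
    have := integrable_covectorInner_differential hf hh hf3 hh3
    have := integrable_covectorInner_differential hh hf hh3 hf3
    simp only [differential_add hf hh, covectorInner_add_left, covectorInner_add_right]
    fun_prop
  zero_mem' := by
    refine ⟨contMDiff_const, MemLp.zero, ?_⟩
    have : ∀ x, differential n (0 : M → ℂ) x = 0 := fun x => mfderiv_const
    simp [this, covectorInner]
  smul_mem' := by
    rintro a f ⟨hf, hf2, hf3⟩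
    refine ⟨(ContinuousLinearMap.mul ℝ ℂ a).contMDiff.comp hf, hf2.const_smul a, ?_⟩
    have : ∀ x, covectorInner (differential n (a • f) x) (differential n (a • f) x) =
        conj a * a * covectorInner (differential n f x) (differential n f x) := fun x => by
      simp only [covectorInner, differential_smul hf, Finset.mul_sum, map_mul]
      exact Finset.sum_congr rfl fun i _ => by ring
    simp only [this]
    exact hf3.const_mul _

/-- The space `smoothSubmodule`, to be endowed with the norm of `H¹`. -/
def SmoothH1 : Type _ := smoothSubmodule n M

instance : AddCommGroup (SmoothH1 n M) := inferInstanceAs (AddCommGroup (smoothSubmodule n M))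

instance : Module ℂ (SmoothH1 n M) := inferInstanceAs (Module ℂ (smoothSubmodule n M))

variable {n M} in
/-- The function underlying an element of `SmoothH1`. -/
def SmoothH1.fn (f : SmoothH1 n M) : M → ℂ := f.1

variable {n M} in
theorem SmoothH1.contMDiff (f : SmoothH1 n M) : ContMDiff (𝓡 n) 𝓘(ℝ, ℂ) ∞ f.fn := f.2.1

variable {n M} in
theorem SmoothH1.memLp (f : SmoothH1 n M) : MemLp f.fn 2 (riemannianVolume n M) := f.2.2.1

variable {n M} in
theorem SmoothH1.integrable (f h : SmoothH1 n M) :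
    Integrable (fun x => covectorInner (differential n f.fn x) (differential n h.fn x))
      (riemannianVolume n M) :=
  integrable_covectorInner_differential f.2.1 h.2.1 f.2.2.2 h.2.2.2

/-- The `H¹` inner product `⟨f, h⟩ = ∫ conj f * h + ∫ ⟨∇ f, ∇ h⟩` on smooth functions. -/
abbrev smoothH1Core : PreInnerProductSpace.Core ℂ (SmoothH1 n M) where
  inner f h := (∫ x, conj (f.fn x) * h.fn x ∂(riemannianVolume n M)) +
    ∫ x, covectorInner (differential n f.fn x) (differential n h.fn x) ∂(riemannianVolume n M)
  conj_inner_symm f h := by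
    simp only [map_add, ← integral_conj, map_mul, Complex.conj_conj, covectorInner_conj_symm]
    simp only [mul_comm]
  re_inner_nonneg f := by
    simp only [covectorInner_self, Complex.conj_mul', ← Complex.ofReal_pow, integral_complex_ofReal,
      map_add, RCLike.re_to_complex, Complex.ofReal_re]
    exact add_nonneg (integral_nonneg fun x => by positivity)
      (integral_nonneg fun x => by positivity)
  add_left f f' h := by
    have e : (f + f').fn = f.fn + f'.fn := rfl
    have hI : ∀ k : SmoothH1 n M,
        Integrable (fun x => conj (k.fn x) * h.fn x) (riemannianVolume n M) :=
      fun k => k.memLp.star.integrable_mul h.memLp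
    have hd : ∀ x, covectorInner (differential n (f.fn + f'.fn) x) (differential n h.fn x) =
        covectorInner (differential n f.fn x) (differential n h.fn x) +
        covectorInner (differential n f'.fn x) (differential n h.fn x) := fun x => by
      rw [differential_add f.contMDiff f'.contMDiff x, covectorInner_add_left]
    simp only [e, hd]
    rw [integral_add (f.integrable h) (f'.integrable h)]
    simp only [Pi.add_apply, map_add, add_mul]
    rw [integral_add (hI f) (hI f')]
    ring
  smul_left f h a := by
    have e : (a • f).fn = a • f.fn := rfl
    have hd : ∀ x, covectorInner (differential n (a • f.fn) x) (differential n h.fn x) =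
        conj a * covectorInner (differential n f.fn x) (differential n h.fn x) := fun x => by
      simp only [covectorInner, differential_smul f.contMDiff, Finset.mul_sum, map_mul, mul_assoc]
    simp only [e, hd, Pi.smul_apply, smul_eq_mul, map_mul, mul_assoc, integral_const_mul, mul_add]

instance : SeminormedAddCommGroup (SmoothH1 n M) :=
  @InnerProductSpace.Core.toSeminormedAddCommGroup ℂ _ _ _ _ (smoothH1Core n M)

instance : InnerProductSpace ℂ (SmoothH1 n M) := InnerProductSpace.ofCore (smoothH1Core n M)

theorem smoothH1_inner_def (f h : SmoothH1 n M) :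
    inner ℂ f h = (∫ x, conj (f.fn x) * h.fn x ∂(riemannianVolume n M)) +
      ∫ x, covectorInner (differential n f.fn x) (differential n h.fn x)
        ∂(riemannianVolume n M) := rfl

/-- The Sobolev space `H¹(M)`, a complex Hilbert space: the completion of the smooth functions for
the norm `‖f‖² = ‖f‖²_{L²} + ‖∇ f‖²_{L²}`. -/
abbrev H1 : Type _ := Completion (SmoothH1 n M)

/-- The inclusion of smooth functions in `L²(M)`. -/
def smoothToL2Linear : SmoothH1 n M →ₗ[ℂ] L2 n M where
  toFun f := f.memLp.toLp f.fn
  map_add' _ _ := rfl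
  map_smul' _ _ := rfl

theorem inner_smoothToL2Linear (f h : SmoothH1 n M) :
    inner ℂ (smoothToL2Linear n M f) (smoothToL2Linear n M h) =
      ∫ x, conj (f.fn x) * h.fn x ∂(riemannianVolume n M) := by
  rw [L2.inner_def]
  refine integral_congr_ae ?_
  filter_upwards [f.memLp.coeFn_toLp, h.memLp.coeFn_toLp] with x hx hx'
  change inner ℂ (f.memLp.toLp f.fn x) (h.memLp.toLp h.fn x) = _
  rw [hx, hx', RCLike.inner_apply, mul_comm]

theorem norm_smoothToL2Linear_le (f : SmoothH1 n M) : ‖smoothToL2Linear n M f‖ ≤ 1 * ‖f‖ := by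
  rw [one_mul]
  refine le_of_sq_le_sq ?_ (norm_nonneg _)
  rw [@norm_sq_eq_re_inner ℂ, @norm_sq_eq_re_inner ℂ, inner_smoothToL2Linear,
    smoothH1_inner_def, map_add]
  refine le_add_of_nonneg_right ?_
  simp only [covectorInner_self, integral_complex_ofReal, RCLike.re_to_complex, Complex.ofReal_re]
  exact integral_nonneg fun x => by positivity

/-- The inclusion of smooth functions in `L²(M)`, as a bounded operator for the `H¹` norm. -/
def smoothToL2 : SmoothH1 n M →L[ℂ] L2 n M :=
  (smoothToL2Linear n M).mkContinuous 1 (norm_smoothToL2Linear_le n M)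

/-- The inclusion `H¹(M) → L²(M)`, the continuous extension of the inclusion of smooth
functions. -/
def toL2 : H1 n M →L[ℂ] L2 n M :=
  (smoothToL2 n M).extend (Completion.toComplL : SmoothH1 n M →L[ℂ] H1 n M)

theorem toL2_coe (f : SmoothH1 n M) : toL2 n M (f : H1 n M) = smoothToL2 n M f :=
  ContinuousLinearMap.extend_eq _ Completion.denseRange_coe
    (Completion.isUniformInducing_coe _) f

variable {n M} in
/-- The Dirichlet form `∫ ⟨∇ f, ∇ h⟩` on `H¹(M)`. -/
def dirichlet (f h : H1 n M) : ℂ := inner ℂ f h - inner ℂ (toL2 n M f) (toL2 n M h)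

/-- On smooth functions, `dirichlet` is the integral of `⟨∇ f, ∇ h⟩`. Since it is continuous, it is
the continuous extension of that integral to `H¹(M)`. -/
theorem dirichlet_coe (f h : SmoothH1 n M) :
    dirichlet (f : H1 n M) (h : H1 n M) =
      ∫ x, covectorInner (differential n f.fn x) (differential n h.fn x)
        ∂(riemannianVolume n M) := by
  have := inner_smoothToL2Linear n M f h
  rw [dirichlet, toL2_coe, toL2_coe, Completion.inner_coe, smoothH1_inner_def]
  simp only [smoothToL2, LinearMap.mkContinuous_apply, this]
  ring

variable {n M} in
/-- `‖∇ f‖²` in `L²`, for `f ∈ H¹(M)`. -/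
def gradNormSq (f : H1 n M) : ℝ := (dirichlet f f).re

/-! ### The kernel of the Laplacian and the Poincaré constants -/

/-- The kernel of the Laplacian, as a subspace of `H¹(M)`: the weak solutions of `Δ h = 0`. -/
def kerLaplacian : Submodule ℂ (H1 n M) where
  carrier := {h | ∀ φ : H1 n M, dirichlet φ h = 0}
  add_mem' := by
    intro h h' H H' φ
    have e : dirichlet φ (h + h') = dirichlet φ h + dirichlet φ h' := by
      simp only [dirichlet, map_add, inner_add_right]; ring
    rw [e, H, H', add_zero]
  zero_mem' := by intro φ; simp [dirichlet]
  smul_mem' := by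
    intro a h H φ
    have e : dirichlet φ (a • h) = a * dirichlet φ h := by
      simp only [dirichlet, map_smul, inner_smul_right]; ring
    rw [e, H, mul_zero]

/-- The energy space `H¹(M) ⊕ L²(M)`, a Hilbert space. -/
abbrev EnergySpace : Type _ := WithLp 2 (H1 n M × L2 n M)

/-- The subspace `ker Δ × {0}` of the energy space. -/
def kerLaplacianProd : Submodule ℂ (EnergySpace n M) :=
  ((kerLaplacian n M).prod ⊥).comap (WithLp.linearEquiv 2 ℂ (H1 n M × L2 n M)).toLinearMap

/-- `C` is a Poincaré constant of `M`: one has `‖f‖ ≤ C ‖∇ f‖` in `L²` for every `f ∈ H¹(M)` which is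
orthogonal to `ker Δ` (that is, which has mean value zero if `M` is connected). -/
def IsPoincareConstant (C : ℝ) : Prop :=
  0 < C ∧ ∀ f ∈ (kerLaplacian n M)ᗮ, ‖toL2 n M f‖ ^ 2 ≤ C ^ 2 * gradNormSq f

/-! ### The damped wave equation -/

variable {n M}

/-- The time derivative `∂_t u(t)`, with values in `L²(M)`. -/
def timeDeriv (u : ℝ → H1 n M) (t : ℝ) : L2 n M := deriv (fun s => toL2 n M (u s)) t

/-- The energy `E(u, t) = 1/2 ∫ |∇ u(t)|² + |∂_t u(t)|²`. -/
def energy (u : ℝ → H1 n M) (t : ℝ) : ℝ := (gradNormSq (u t) + ‖timeDeriv u t‖ ^ 2) / 2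

/-- `u` is a (weak, finite energy) solution of `(∂_t² - Δ + W ∂_t) u = 0`: it is in
`C⁰(ℝ, H¹(M)) ∩ C¹(ℝ, L²(M))`, and for every `φ ∈ H¹(M)`
`d/dt ⟨φ, ∂_t u⟩ + ⟨∇ φ, ∇ u⟩ + ⟨φ, W ∂_t u⟩ = 0`. -/
structure IsSolution (W : M × ℝ → ℝ) (u : ℝ → H1 n M) : Prop where
  continuous : Continuous u
  contDiff : ContDiff ℝ 1 fun t => toL2 n M (u t)
  weak_equation : ∀ (φ : H1 n M) (t : ℝ),
    HasDerivAt (fun s => inner ℂ (toL2 n M φ) (timeDeriv u s))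
      (-dirichlet φ (u t) -
        ∫ x, (W (x, t) : ℂ) * (conj (toL2 n M φ x) * timeDeriv u t x) ∂(riemannianVolume n M)) t

end Manifold

end DampedWave

end

open DampedWave

/-!
# Poincaré constants and observability for the damped wave equation

*Existence of a Poincaré constant.* On a bounded convex open set of a Euclidean space, the double
integral of `|F x - F y|²` is bounded by the integral of `|∇ F|²`
(`lintegral_lintegral_enorm_sub_sq_le`). In a small ball of a chart, the coefficients of the metric
are bounded and the density of the volume is bounded above and below. The supremum which defines
the Riemannian volume restricts there to the measure `√(det g) dy`, by the change of variables
formula (`restrict_riemannianVolume_le`), so that every point has a neighbourhood `U` of finite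
volume with a Poincaré–Wirtinger inequality (`exists_nhds_poincare`). Summing over a finite cover,
`‖f‖²` is bounded by `‖∇ f‖²` and the squares of finitely many integrals `∫_U f`
(`exists_finite_rank_poincare`). These integrals take their values in a finite-dimensional space,
so that a compactness argument removes them on the orthogonal of the kernel of the Dirichlet form
(`exists_poincare_of_finite_rank`). Neither Rellich's theorem nor the connectedness of `M` is
needed.

*The inequality.* A weak solution `u` is not regular enough for `u_t` to be a test function, but its
averages in time over intervals of length `h` are; as `h → 0` this gives the energy identity
(`IsAbstractSolution.energy_sub_energy`), so that the energy `E` is nonincreasing. Let `Π` be the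
orthogonal projection onto `ker Δ`, which for functions in `H¹` is the same in `H¹` and in `L²`.
Then `d/dt Re ⟨u - Π u, u_t⟩ = ‖u_t - Π u_t‖² - ‖∇ u‖² - Re ⟨u - Π u, W u_t⟩`, where
`‖∇ u‖² = 2 E - ‖u_t‖²`, and the Poincaré inequality for `u - Π u` and Young's inequality with
weight `ε` bound the other terms by `‖u_t‖²` and `ε C² E(t₁)`. This is integrated over `[a, b]`,
where `a` and `b` are at distance at most `1` from `t₁` and `t₂` and chosen such that the boundary
terms are bounded by the integral of `‖u_t‖²` (`IsAbstractSolution.observability`). These arguments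
take place in abstract Hilbert spaces, and the manifold only enters through the Poincaré inequality
and the continuity in time of `W u_t`.
-/

namespace DampedWave

/-! ### The Poincaré inequality on convex open sets of a Euclidean space -/

/-- Cauchy–Schwarz on a space of measure at most `1`. -/
theorem sq_lintegral_le_lintegral_sq {α : Type*} [MeasurableSpace α] {μ : Measure α}
    (hμ : μ Set.univ ≤ 1) {f : α → ENNReal} (hf : AEMeasurable f μ) :
    (∫⁻ a, f a ∂μ) ^ 2 ≤ ∫⁻ a, f a ^ 2 ∂μ := by
  have h := ENNReal.lintegral_mul_le_Lp_mul_Lq μ Real.HolderConjugate.two_two hf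
    (aemeasurable_const (b := (1 : ENNReal)))
  simp only [Pi.mul_apply, mul_one, ENNReal.one_rpow, lintegral_const, one_mul] at h
  have h1 : (∫⁻ a, f a ∂μ) ≤ (∫⁻ a, f a ^ (2 : ℝ) ∂μ) ^ (1 / 2 : ℝ) :=
    h.trans (mul_le_of_le_one_right' (ENNReal.rpow_le_one hμ (by norm_num)))
  calc (∫⁻ a, f a ∂μ) ^ 2 ≤ ((∫⁻ a, f a ^ (2 : ℝ) ∂μ) ^ (1 / 2 : ℝ)) ^ 2 := by gcongr
    _ = ∫⁻ a, f a ^ 2 ∂μ := by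
      rw [← ENNReal.rpow_natCast, ← ENNReal.rpow_mul]
      norm_num

theorem enorm_sub_sq_le {G : Type*} [NormedAddCommGroup G] (a b m : G) :
    ‖a - b‖ₑ ^ 2 ≤ 2 * (‖m - a‖ₑ ^ 2 + ‖m - b‖ₑ ^ 2) := by
  have h : ‖a - b‖ₑ ≤ ‖m - a‖ₑ + ‖m - b‖ₑ := by
    have : a - b = (m - b) - (m - a) := by abel
    rw [this, add_comm]
    exact enorm_sub_le
  calc ‖a - b‖ₑ ^ 2 ≤ (‖m - a‖ₑ + ‖m - b‖ₑ) ^ 2 := by gcongr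
    _ ≤ 2 * (‖m - a‖ₑ ^ 2 + ‖m - b‖ₑ ^ 2) := by
      have := ENNReal.rpow_add_le_mul_rpow_add_rpow ‖m - a‖ₑ ‖m - b‖ₑ (p := 2) (by norm_num)
      norm_num at this
      exact_mod_cast this

section Euclidean

variable {E : Type*} [NormedAddCommGroup E] [NormedSpace ℝ E]
  {G : Type*} [NormedAddCommGroup G] [NormedSpace ℝ G]

theorem enorm_midpoint_sub_sq_le {s : Set E} (hs : IsOpen s) (hc : Convex ℝ s) {d : ENNReal}
    (hd : ∀ x ∈ s, ∀ y ∈ s, ‖y - x‖ₑ ≤ d) {F : E → G} (hF : ContDiffOn ℝ 1 F s) {x y : E}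
    (hx : x ∈ s) (hy : y ∈ s) :
    ‖F (x + (1 / 2 : ℝ) • (y - x)) - F x‖ₑ ^ 2 ≤ d ^ 2 * ∫⁻ t in Set.Icc (0 : ℝ) (1 / 2),
      s.indicator (fun z => ‖fderiv ℝ F z‖ₑ ^ 2) (x + t • (y - x)) := by
  set γ : ℝ → E := fun t => x + t • (y - x) with hγ
  have hγs : ∀ t ∈ Set.Icc (0 : ℝ) (1 / 2), γ t ∈ s := fun t ht =>
    hc.add_smul_sub_mem hx hy ⟨ht.1, ht.2.trans (by norm_num)⟩
  have hγd : ContDiff ℝ 1 γ := by fun_prop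
  have hcd : ContDiffOn ℝ 1 (F ∘ γ) (Set.Icc (0 : ℝ) (1 / 2)) :=
    hF.comp hγd.contDiffOn hγs
  have h1 := enorm_sub_le_lintegral_deriv_of_contDiffOn_Icc hcd (by norm_num)
  simp only [Function.comp_apply, hγ, zero_smul, add_zero] at h1
  have hderiv : ∀ t ∈ Set.Icc (0 : ℝ) (1 / 2),
      ‖deriv (F ∘ γ) t‖ₑ ≤ d * ‖fderiv ℝ F (γ t)‖ₑ := by
    intro t ht
    have hFd : DifferentiableAt ℝ F (γ t) :=
      (hF.differentiableOn (by norm_num)).differentiableAt (hs.mem_nhds (hγs t ht))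
    have hg : HasDerivAt γ (y - x) t := by
      have := ((hasDerivAt_id t).smul_const (y - x)).const_add x
      rwa [one_smul] at this
    have := (hFd.hasFDerivAt.comp_hasDerivAt t hg).deriv
    rw [this, mul_comm]
    exact (ContinuousLinearMap.le_opENorm _ _).trans (by gcongr; exact hd x hx y hy)
  have hcont : ContinuousOn (fun t => ‖fderiv ℝ F (γ t)‖ₑ) (Set.Icc (0 : ℝ) (1 / 2)) :=
    ((hF.continuousOn_fderiv_of_isOpen hs le_rfl).comp hγd.continuous.continuousOn hγs).enorm
  have hmeas : AEMeasurable (fun t => ‖fderiv ℝ F (γ t)‖ₑ)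
      (volume.restrict (Set.Icc (0 : ℝ) (1 / 2))) := hcont.aemeasurable measurableSet_Icc
  calc ‖F (x + (1 / 2 : ℝ) • (y - x)) - F x‖ₑ ^ 2
      ≤ (∫⁻ t in Set.Icc (0 : ℝ) (1 / 2), d * ‖fderiv ℝ F (γ t)‖ₑ) ^ 2 := by
        gcongr
        exact h1.trans (setLIntegral_mono' measurableSet_Icc hderiv)
    _ ≤ ∫⁻ t in Set.Icc (0 : ℝ) (1 / 2), (d * ‖fderiv ℝ F (γ t)‖ₑ) ^ 2 := by
        refine sq_lintegral_le_lintegral_sq ?_ (hmeas.const_mul d)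
        simp only [Measure.restrict_apply_univ, Real.volume_Icc]
        exact ENNReal.ofReal_le_one.2 (by norm_num)
    _ = d ^ 2 * ∫⁻ t in Set.Icc (0 : ℝ) (1 / 2), ‖fderiv ℝ F (γ t)‖ₑ ^ 2 := by
        simp only [mul_pow]
        exact lintegral_const_mul'' _ (hmeas.pow_const 2)
    _ = _ := by
        congr 1
        refine setLIntegral_congr_fun measurableSet_Icc fun t ht => ?_
        exact (Set.indicator_of_mem (hγs t ht) fun z => ‖fderiv ℝ F z‖ₑ ^ 2).symm

variable [FiniteDimensional ℝ E] [MeasurableSpace E] [BorelSpace E]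

/-- Contracting space towards `y` by a factor `1 - t ≥ 1 / 2` increases integrals by at most
`2 ^ dim E`. -/
theorem lintegral_comp_contraction_le (μ : Measure E) [μ.IsAddHaarMeasure] {φ : E → ENNReal}
    (hφ : Measurable φ) (y : E) {t : ℝ} (ht : t ≤ 1 / 2) :
    ∫⁻ x, φ (x + t • (y - x)) ∂μ ≤ 2 ^ Module.finrank ℝ E * ∫⁻ x, φ x ∂μ := by
  have hs : 1 / 2 ≤ 1 - t := by linarith
  have hs0 : 1 - t ≠ 0 := by linarith
  have h1 : ∀ x, φ (x + t • (y - x)) = φ ((1 - t) • x + t • y) := fun x => by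
    congr 1; module
  have hm : Measurable fun z => φ (z + t • y) := hφ.comp (measurable_add_const _)
  calc ∫⁻ x, φ (x + t • (y - x)) ∂μ
      = ∫⁻ z, φ (z + t • y) ∂(Measure.map ((1 - t) • ·) μ) := by
        rw [lintegral_map hm (measurable_const_smul _)]
        simp only [h1]
    _ = ENNReal.ofReal |((1 - t) ^ Module.finrank ℝ E)⁻¹| * ∫⁻ x, φ x ∂μ := by
        rw [Measure.map_addHaar_smul μ hs0, lintegral_smul_measure,
          lintegral_add_right_eq_self, smul_eq_mul]
    _ ≤ 2 ^ Module.finrank ℝ E * ∫⁻ x, φ x ∂μ := by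
        gcongr
        have h2 : |((1 - t) ^ Module.finrank ℝ E)⁻¹| ≤ 2 ^ Module.finrank ℝ E := by
          rw [abs_of_nonneg (by positivity), ← inv_pow]
          gcongr
          rw [inv_le_comm₀ (by linarith) (by norm_num)]
          linarith
        calc ENNReal.ofReal |((1 - t) ^ Module.finrank ℝ E)⁻¹|
            ≤ ENNReal.ofReal (2 ^ Module.finrank ℝ E) := ENNReal.ofReal_le_ofReal h2
          _ = 2 ^ Module.finrank ℝ E := by
            rw [ENNReal.ofReal_pow (by norm_num)]; norm_num

/-- The Poincaré–Wirtinger inequality on a bounded convex open set, in a form which does not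
mention mean values. The segment from `x` to `y` is cut at its midpoint: each half is contained
in the image of `s` by contractions towards one endpoint by a factor at least `1 / 2`, for which
the change of variables costs at most `2 ^ dim E`. -/
theorem lintegral_lintegral_enorm_sub_sq_le [CompleteSpace G] (μ : Measure E)
    [μ.IsAddHaarMeasure] {s : Set E}
    (hs : IsOpen s) (hc : Convex ℝ s) {d : ENNReal} (hd : ∀ x ∈ s, ∀ y ∈ s, ‖y - x‖ₑ ≤ d)
    {F : E → G} (hF : ContDiffOn ℝ 1 F s) :
    ∫⁻ x in s, ∫⁻ y in s, ‖F x - F y‖ₑ ^ 2 ∂μ ∂μ ≤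
      4 * d ^ 2 * μ s * 2 ^ Module.finrank ℝ E * ∫⁻ x in s, ‖fderiv ℝ F x‖ₑ ^ 2 ∂μ := by
  set φ : E → ENNReal := s.indicator (fun z => ‖fderiv ℝ F z‖ₑ ^ 2) with hφ
  have hφm : Measurable φ :=
    ((measurable_fderiv ℝ F).enorm.pow_const 2).indicator hs.measurableSet
  have hφi : ∫⁻ x, φ x ∂μ = ∫⁻ x in s, ‖fderiv ℝ F x‖ₑ ^ 2 ∂μ :=
    lintegral_indicator hs.measurableSet _
  set g : E → E → ENNReal := fun x y => ∫⁻ t in Set.Icc (0 : ℝ) (1 / 2), φ (x + t • (y - x))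
    with hg
  have hgm : Measurable (Function.uncurry g) := by
    refine Measurable.lintegral_prod_right' (f := fun p : (E × E) × ℝ =>
      φ (p.1.1 + p.2 • (p.1.2 - p.1.1))) ?_
    refine hφm.comp ?_
    fun_prop
  have hgx : ∀ y, Measurable fun x => g x y := fun y => hgm.comp (measurable_prodMk_right)
  have hgy : ∀ x, Measurable fun y => g x y := fun x => hgm.comp (measurable_prodMk_left)
  have hgI : ∀ y, ∫⁻ x in s, g x y ∂μ ≤ 2 ^ Module.finrank ℝ E * ∫⁻ x, φ x ∂μ := by
    intro y
    calc ∫⁻ x in s, g x y ∂μ ≤ ∫⁻ x, g x y ∂μ := setLIntegral_le_lintegral _ _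
      _ = ∫⁻ t in Set.Icc (0 : ℝ) (1 / 2), ∫⁻ x, φ (x + t • (y - x)) ∂μ := by
        refine lintegral_lintegral_swap (Measurable.aemeasurable ?_)
        refine hφm.comp ?_
        fun_prop
      _ ≤ ∫⁻ t in Set.Icc (0 : ℝ) (1 / 2), 2 ^ Module.finrank ℝ E * ∫⁻ x, φ x ∂μ :=
        setLIntegral_mono' measurableSet_Icc fun t ht =>
          lintegral_comp_contraction_le μ hφm y ht.2
      _ ≤ 2 ^ Module.finrank ℝ E * ∫⁻ x, φ x ∂μ := by
        rw [setLIntegral_const, Real.volume_Icc]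
        exact mul_le_of_le_one_right' (ENNReal.ofReal_le_one.2 (by norm_num))
  have hpt : ∀ x ∈ s, ∀ y ∈ s, ‖F x - F y‖ₑ ^ 2 ≤ 2 * d ^ 2 * (g x y + g y x) := by
    intro x hx y hy
    have h1 := enorm_midpoint_sub_sq_le hs hc hd hF hx hy
    have h2 := enorm_midpoint_sub_sq_le hs hc hd hF hy hx
    have e : y + (1 / 2 : ℝ) • (x - y) = x + (1 / 2 : ℝ) • (y - x) := by module
    rw [e] at h2
    refine (enorm_sub_sq_le _ _ (F (x + (1 / 2 : ℝ) • (y - x)))).trans ?_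
    calc _ ≤ 2 * (d ^ 2 * g x y + d ^ 2 * g y x) := by gcongr
      _ = _ := by ring
  calc ∫⁻ x in s, ∫⁻ y in s, ‖F x - F y‖ₑ ^ 2 ∂μ ∂μ
      ≤ ∫⁻ x in s, ∫⁻ y in s, 2 * d ^ 2 * (g x y + g y x) ∂μ ∂μ :=
        setLIntegral_mono' hs.measurableSet fun x hx =>
          setLIntegral_mono' hs.measurableSet fun y hy => hpt x hx y hy
    _ = 2 * d ^ 2 * (∫⁻ x in s, ∫⁻ y in s, g x y ∂μ ∂μ + ∫⁻ x in s, ∫⁻ y in s, g y x ∂μ ∂μ) := by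
        have h1 : ∀ x, ∫⁻ y in s, 2 * d ^ 2 * (g x y + g y x) ∂μ =
            2 * d ^ 2 * (∫⁻ y in s, g x y ∂μ + ∫⁻ y in s, g y x ∂μ) := fun x => by
          rw [lintegral_const_mul _ (by exact (hgy x).add (hgx x)), lintegral_add_left (hgy x)]
        simp only [h1]
        have h2 : Measurable fun x => ∫⁻ y in s, g x y ∂μ := hgm.lintegral_prod_right
        have h3 : Measurable fun x => ∫⁻ y in s, g y x ∂μ := hgm.lintegral_prod_left
        rw [lintegral_const_mul _ (by exact h2.add h3), lintegral_add_left h2]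
    _ = 2 * d ^ 2 * (∫⁻ x in s, ∫⁻ y in s, g y x ∂μ ∂μ + ∫⁻ x in s, ∫⁻ y in s, g y x ∂μ ∂μ) := by
        rw [lintegral_lintegral_swap hgm.aemeasurable]
    _ ≤ 2 * d ^ 2 * (2 ^ Module.finrank ℝ E * (∫⁻ x, φ x ∂μ) * μ s +
          2 ^ Module.finrank ℝ E * (∫⁻ x, φ x ∂μ) * μ s) := by
        have h : ∫⁻ x in s, ∫⁻ y in s, g y x ∂μ ∂μ ≤
            2 ^ Module.finrank ℝ E * (∫⁻ x, φ x ∂μ) * μ s := by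
          rw [← setLIntegral_const]
          exact lintegral_mono fun x => hgI x
        gcongr
    _ = _ := by rw [hφi]; ring

end Euclidean

/-! ### The metric and the volume in a chart -/

section Chart

variable {n : ℕ} {M : Type*} [TopologicalSpace M] [ChartedSpace (EuclideanSpace ℝ (Fin n)) M]

local notation "ℰ" => EuclideanSpace ℝ (Fin n)

variable [IsManifold (𝓡 n) ∞ M]

theorem mdifferentiableAt_chart_symm (c : M) {y : ℰ} (hy : y ∈ (chartAt ℰ c).target) :
    MDifferentiableAt (𝓡 n) (𝓡 n) (chartAt ℰ c).symm y := by
  have : IsManifold (𝓡 n) 1 M := IsManifold.of_le (n := ∞) (by norm_cast)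
  exact mdifferentiableAt_atlas_symm (chart_mem_atlas _ c) hy

theorem mfderiv_chart_symm_injective (c : M) {y : ℰ} (hy : y ∈ (chartAt ℰ c).target) :
    Function.Injective (mfderiv (𝓡 n) (𝓡 n) (chartAt ℰ c).symm y) := by
  have : IsManifold (𝓡 n) 1 M := IsManifold.of_le (n := ∞) (by norm_cast)
  exact (mdifferentiable_chart (I := 𝓡 n) c).symm.mfderiv_injective hy

/-- The transition map from the chart at `c` to the chart at `c'`. -/
def transition (c c' : M) : ℰ → ℰ := chartAt ℰ c' ∘ (chartAt ℰ c).symm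

theorem hasFDerivAt_transition {c c' : M} {y : ℰ} (hy : y ∈ (chartAt ℰ c).target)
    (hy' : (chartAt ℰ c).symm y ∈ (chartAt ℰ c').source) :
    HasFDerivAt (transition c c') (fderiv ℝ (transition c c') y) y := by
  have : IsManifold (𝓡 n) 1 M := IsManifold.of_le (n := ∞) (by norm_cast)
  have h1 := mdifferentiableAt_chart_symm c hy
  have h2 : MDifferentiableAt (𝓡 n) (𝓡 n) (chartAt ℰ c') ((chartAt ℰ c).symm y) :=
    mdifferentiableAt_atlas (chart_mem_atlas _ c') hy'
  exact (h2.comp y h1).differentiableAt.hasFDerivAt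

theorem mfderiv_chart_symm_eq_comp_transition {c c' : M} {y : ℰ} (hy : y ∈ (chartAt ℰ c).target)
    (hy' : (chartAt ℰ c).symm y ∈ (chartAt ℰ c').source) (v : ℰ) :
    (mfderiv (𝓡 n) (𝓡 n) (chartAt ℰ c).symm y v : ℰ) =
      mfderiv (𝓡 n) (𝓡 n) (chartAt ℰ c').symm (transition c c' y)
        (fderiv ℝ (transition c c') y v) := by
  have hτ : MDifferentiableAt (𝓡 n) (𝓡 n) (transition c c') y :=
    (hasFDerivAt_transition hy hy').differentiableAt.mdifferentiableAt
  have h3 : MDifferentiableAt (𝓡 n) (𝓡 n) (chartAt ℰ c').symm (transition c c' y) :=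
    mdifferentiableAt_chart_symm c' ((chartAt ℰ c').map_source hy')
  have h4 := mfderiv_comp y h3 hτ
  have h5 : (chartAt ℰ c).symm =ᶠ[nhds y] (chartAt ℰ c').symm ∘ transition c c' := by
    have ho : (chartAt ℰ c).target ∩ (chartAt ℰ c).symm ⁻¹' (chartAt ℰ c').source ∈ nhds y :=
      ((chartAt ℰ c).symm.isOpen_inter_preimage (chartAt ℰ c').open_source).mem_nhds ⟨hy, hy'⟩
    filter_upwards [ho] with z hz
    exact ((chartAt ℰ c').left_inv hz.2).symm
  have h6 := h5.mfderiv_eq (I := 𝓡 n) (I' := 𝓡 n)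
  have h7 := DFunLike.congr_fun (h6.trans h4) v
  rw [mfderiv_eq_fderiv] at h7
  exact h7

variable [RiemannianBundle (fun x : M => TangentSpace (𝓡 n) x)]

variable (n) in
/-- The inner product of the tangent space at `x`, on the model space: it lets one change the base
point without changing the type of the vectors. -/
noncomputable def metricAt (x : M) (v w : ℰ) : ℝ :=
  inner ℝ (show TangentSpace (𝓡 n) x from v) (show TangentSpace (𝓡 n) x from w)

omit [IsManifold (𝓡 n) ∞ M] in
theorem chartMetric_apply (c : M) (y : ℰ) (i j : Fin n) :
    chartMetric n c y i j = metricAt n ((chartAt ℰ c).symm y)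
      (mfderiv (𝓡 n) (𝓡 n) (chartAt ℰ c).symm y (EuclideanSpace.single i 1))
      (mfderiv (𝓡 n) (𝓡 n) (chartAt ℰ c).symm y (EuclideanSpace.single j 1)) := rfl

theorem det_chartMetric_pos (c : M) {y : ℰ} (hy : y ∈ (chartAt ℰ c).target) :
    0 < (chartMetric n c y).det := by
  have h1 : LinearIndependent ℝ fun i : Fin n =>
      (mfderiv (𝓡 n) (𝓡 n) (chartAt ℰ c).symm y (EuclideanSpace.single i 1) :
        TangentSpace (𝓡 n) ((chartAt ℰ c).symm y)) := by
    have h := (EuclideanSpace.basisFun (Fin n) ℝ).toBasis.linearIndependent.map'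
      (mfderiv (𝓡 n) (𝓡 n) (chartAt ℰ c).symm y).toLinearMap
      (LinearMap.ker_eq_bot.2 (mfderiv_chart_symm_injective c hy))
    simp only [Function.comp_def, OrthonormalBasis.coe_toBasis, EuclideanSpace.basisFun_apply] at h
    exact h
  exact (Matrix.posDef_gram_of_linearIndependent (𝕜 := ℝ) h1).det_pos

theorem det_chartMetric_transition {c c' : M} {y : ℰ} (hy : y ∈ (chartAt ℰ c).target)
    (hy' : (chartAt ℰ c).symm y ∈ (chartAt ℰ c').source) :
    (chartMetric n c y).det = (fderiv ℝ (transition c c') y).det ^ 2 *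
      (chartMetric n c' (transition c c' y)).det := by
  set b := (EuclideanSpace.basisFun (Fin n) ℝ).toBasis
  set A := LinearMap.toMatrix b b (fderiv ℝ (transition c c') y).toLinearMap with hA
  have hdet : (fderiv ℝ (transition c c') y).det = A.det := by
    rw [hA, LinearMap.det_toMatrix]
  have hpt : (chartAt ℰ c).symm y = (chartAt ℰ c').symm (transition c c' y) :=
    ((chartAt ℰ c').left_inv hy').symm
  have hexp : ∀ i, (mfderiv (𝓡 n) (𝓡 n) (chartAt ℰ c).symm y (EuclideanSpace.single i 1) : ℰ) =
      ∑ k, A k i • mfderiv (𝓡 n) (𝓡 n) (chartAt ℰ c').symm (transition c c' y)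
        (EuclideanSpace.single k 1) := by
    intro i
    rw [mfderiv_chart_symm_eq_comp_transition hy hy']
    have : fderiv ℝ (transition c c') y (EuclideanSpace.single i 1) =
        ∑ k, A k i • (EuclideanSpace.single k (1 : ℝ) : ℰ) := by
      rw [← b.sum_repr (fderiv ℝ (transition c c') y (EuclideanSpace.single i 1))]
      simp [b, hA, LinearMap.toMatrix_apply]
    let D : ℰ →L[ℝ] ℰ := mfderiv (𝓡 n) (𝓡 n) (chartAt ℰ c').symm (transition c c' y)
    change D _ = ∑ k, A k i • D _
    simp only [this, map_sum, map_smul]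
  have hG : chartMetric n c y = A.transpose * chartMetric n c' (transition c c' y) * A := by
    ext i j
    rw [chartMetric_apply, hexp i, hexp j, hpt]
    simp only [metricAt, Matrix.mul_apply, Matrix.transpose_apply, Finset.sum_mul]
    erw [sum_inner]
    simp only [chartMetric_apply]
    rw [Finset.sum_comm]
    refine Finset.sum_congr rfl fun k _ => ?_
    erw [inner_sum]
    refine Finset.sum_congr rfl fun l _ => ?_
    erw [real_inner_smul_left, real_inner_smul_right]
    simp only [metricAt]
    ring_nf
  rw [hG, Matrix.det_mul, Matrix.det_mul, Matrix.det_transpose, hdet]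
  ring

end Chart

section Volume

variable {n : ℕ} {M : Type*} [TopologicalSpace M] [ChartedSpace (EuclideanSpace ℝ (Fin n)) M]

local notation "ℰ" => EuclideanSpace ℝ (Fin n)

variable [RiemannianBundle (fun x : M => TangentSpace (𝓡 n) x)]
  [MeasurableSpace M] [BorelSpace M]

omit [RiemannianBundle (fun x : M => TangentSpace (𝓡 n) x)] in
/-- The inverse of a chart is arbitrary outside of the target of the chart, but this set is negligible
for the measure whose image is `chartVolume`. -/
theorem aemeasurable_chart_symm (c : M) (ρ : ℰ → ENNReal) :
    AEMeasurable (chartAt ℰ c).symm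
      ((volume.restrict (chartAt ℰ c).target).withDensity ρ) :=
  ((chartAt ℰ c).continuousOn_symm.aemeasurable
    (chartAt ℰ c).open_target.measurableSet).mono_ac (withDensity_absolutelyContinuous _ _)

omit [RiemannianBundle (fun x : M => TangentSpace (𝓡 n) x)] in
theorem measurableSet_target_inter_preimage (c : M) {s : Set M} (hs : MeasurableSet s) :
    MeasurableSet ((chartAt ℰ c).target ∩ (chartAt ℰ c).symm ⁻¹' s) := by
  have h := (continuousOn_iff_continuous_domRestrict.1 (chartAt ℰ c).continuousOn_symm).measurable hs
  have := (chartAt ℰ c).open_target.measurableSet.subtype_image h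
  rwa [Set.domRestrict_eq, Set.preimage_comp, Subtype.image_preimage_coe] at this

theorem chartVolume_apply (c : M) {s : Set M} (hs : MeasurableSet s) :
    chartVolume n c s = ∫⁻ y in (chartAt ℰ c).target ∩ (chartAt ℰ c).symm ⁻¹' s,
      ENNReal.ofReal √(chartMetric n c y).det := by
  have ht := (chartAt ℰ c).open_target.measurableSet
  rw [chartVolume, Measure.map_apply_of_aemeasurable (aemeasurable_chart_symm c _) hs,
    ← restrict_withDensity ht, Measure.restrict_apply' ht, Set.inter_comm,
    withDensity_apply _ (measurableSet_target_inter_preimage c hs)]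

variable [IsManifold (𝓡 n) ∞ M]

/-- The Riemannian volumes in two charts agree on the overlap: this is the change of variables
formula for the transition map. -/
theorem chartVolume_eq_of_subset {c c' : M} {s : Set M} (hs : MeasurableSet s)
    (hc : s ⊆ (chartAt ℰ c).source) (hc' : s ⊆ (chartAt ℰ c').source) :
    chartVolume n c' s = chartVolume n c s := by
  rw [chartVolume_apply c hs, chartVolume_apply c' hs]
  set A := (chartAt ℰ c).target ∩ (chartAt ℰ c).symm ⁻¹' s with hA
  have hAm : MeasurableSet A := measurableSet_target_inter_preimage c hs
  have hy' : ∀ y ∈ A, (chartAt ℰ c).symm y ∈ (chartAt ℰ c').source := fun y hy => hc' hy.2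
  have hinj : Set.InjOn (transition c c') A := by
    intro y hy z hz h
    exact (chartAt ℰ c).symm.injOn hy.1 hz.1
      ((chartAt ℰ c').injOn (hy' y hy) (hy' z hz) h)
  have himage : (chartAt ℰ c').target ∩ (chartAt ℰ c').symm ⁻¹' s = transition c c' '' A := by
    ext z
    constructor
    · rintro ⟨hz, hzs⟩
      refine ⟨chartAt ℰ c ((chartAt ℰ c').symm z), ⟨(chartAt ℰ c).map_source (hc hzs), ?_⟩, ?_⟩
      · rw [Set.mem_preimage, (chartAt ℰ c).left_inv (hc hzs)]
        exact hzs
      · rw [transition, Function.comp_apply, (chartAt ℰ c).left_inv (hc hzs),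
          (chartAt ℰ c').right_inv hz]
    · rintro ⟨y, hy, rfl⟩
      refine ⟨(chartAt ℰ c').map_source (hy' y hy), ?_⟩
      rw [Set.mem_preimage, transition, Function.comp_apply, (chartAt ℰ c').left_inv (hy' y hy)]
      exact hy.2
  rw [himage, lintegral_image_eq_lintegral_abs_det_fderiv_mul volume hAm
    (fun y hy => (hasFDerivAt_transition hy.1 (hy' y hy)).hasFDerivWithinAt) hinj]
  refine setLIntegral_congr_fun hAm fun y hy => ?_
  rw [det_chartMetric_transition hy.1 (hy' y hy), Real.sqrt_mul (sq_nonneg _), Real.sqrt_sq_eq_abs,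
    ENNReal.ofReal_mul (abs_nonneg _)]

omit [BorelSpace M] [IsManifold (𝓡 n) ∞ M] in
theorem chartVolume_le_riemannianVolume (c : M) : chartVolume n c ≤ riemannianVolume n M :=
  le_iSup (fun c : M => chartVolume n c) c

omit [IsManifold (𝓡 n) ∞ M] in
theorem chartVolume_apply_compl_source (c : M) :
    chartVolume n c (chartAt ℰ c).sourceᶜ = 0 := by
  rw [chartVolume_apply c (chartAt ℰ c).open_source.measurableSet.compl]
  have : (chartAt ℰ c).target ∩ (chartAt ℰ c).symm ⁻¹' (chartAt ℰ c).sourceᶜ = ∅ := by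
    ext y
    simp only [Set.mem_inter_iff, Set.mem_preimage, Set.mem_compl_iff, Set.mem_empty_iff_false,
      iff_false, not_and, not_not]
    exact fun hy => (chartAt ℰ c).map_target hy
  rw [this, Measure.restrict_empty, lintegral_zero_measure]

/-- The supremum defining the Riemannian volume is attained in each chart domain: all the
`chartVolume n c'` are bounded by the measure equal to `chartVolume n c` on the domain of the chart
at `c`, and to the largest possible measure outside of it. -/
theorem restrict_riemannianVolume_le (c : M) :
    (riemannianVolume n M).restrict (chartAt ℰ c).source ≤ chartVolume n c := by
  set U := (chartAt ℰ c).source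
  have hU : MeasurableSet U := (chartAt ℰ c).open_source.measurableSet
  have h : riemannianVolume n M ≤ chartVolume n c + (⊤ : Measure M).restrict Uᶜ := by
    refine iSup_le fun c' => Measure.le_iff.2 fun s hs => ?_
    have h1 : chartVolume n c' (s ∩ U) ≤ chartVolume n c s := by
      have h2 : chartVolume n c' (s ∩ U) =
          chartVolume n c' (s ∩ U ∩ (chartAt ℰ c').source) := by
        refine le_antisymm ?_ (measure_mono Set.inter_subset_left)
        rw [← measure_inter_add_sdiff (s ∩ U) (chartAt ℰ c').open_source.measurableSet]
        have : chartVolume n c' ((s ∩ U) \ (chartAt ℰ c').source) = 0 :=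
          measure_mono_null (Set.sdiff_subset_compl _ _) (chartVolume_apply_compl_source c')
        rw [this, add_zero]
      rw [h2, chartVolume_eq_of_subset
        ((hs.inter hU).inter (chartAt ℰ c').open_source.measurableSet)
        (Set.inter_subset_left.trans Set.inter_subset_right) Set.inter_subset_right]
      exact measure_mono (Set.inter_subset_left.trans Set.inter_subset_left)
    have h3 : chartVolume n c' (s \ U) ≤ (⊤ : Measure M).restrict Uᶜ s := by
      rw [Measure.restrict_apply hs, ← Set.sdiff_eq]
      exact Measure.le_iff'.1 le_top _
    rw [← measure_inter_add_sdiff s hU, Measure.add_apply]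
    exact add_le_add h1 h3
  calc (riemannianVolume n M).restrict U
      ≤ (chartVolume n c + (⊤ : Measure M).restrict Uᶜ).restrict U := Measure.restrict_mono_measure h U
    _ = (chartVolume n c).restrict U := by
      rw [Measure.restrict_add, Measure.restrict_restrict hU, Set.inter_compl_self,
        Measure.restrict_empty, add_zero]
    _ ≤ chartVolume n c := Measure.restrict_le_self

end Volume

section Continuity

variable {n : ℕ} {M : Type*} [TopologicalSpace M] [ChartedSpace (EuclideanSpace ℝ (Fin n)) M]

local notation "ℰ" => EuclideanSpace ℝ (Fin n)

variable [IsManifold (𝓡 n) ∞ M] [RiemannianBundle (fun x : M => TangentSpace (𝓡 n) x)]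
  [IsContMDiffRiemannianBundle (𝓡 n) ∞ (EuclideanSpace ℝ (Fin n))
    (fun x : M => TangentSpace (𝓡 n) x)]

theorem continuousOn_chartMetric (c : M) :
    ContinuousOn (chartMetric n c) (chartAt ℰ c).target := by
  have : IsManifold (𝓡 n) 1 M := IsManifold.of_le (n := ∞) (by norm_cast)
  have : IsContinuousRiemannianBundle (EuclideanSpace ℝ (Fin n))
      (fun x : M => TangentSpace (𝓡 n) x) := by
    obtain ⟨g, hg, hg'⟩ := IsContMDiffRiemannianBundle.exists_contMDiff (IB := 𝓡 n) (n := ∞)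
      (F := EuclideanSpace ℝ (Fin n)) (E := fun x : M => TangentSpace (𝓡 n) x)
    exact ⟨g, hg.continuous, hg'⟩
  have hψ : ContMDiffOn (𝓡 n) (𝓡 n) 1 (chartAt ℰ c).symm (chartAt ℰ c).target :=
    contMDiffOn_chart_symm
  have ht := hψ.continuousOn_tangentMapWithin le_rfl
    (chartAt ℰ c).open_target.uniqueMDiffOn
  have hs : ∀ i : Fin n, ContinuousOn (fun y => (⟨(chartAt ℰ c).symm y,
      mfderiv (𝓡 n) (𝓡 n) (chartAt ℰ c).symm y (EuclideanSpace.single i 1)⟩ :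
        TotalSpace ℰ (fun x : M => TangentSpace (𝓡 n) x))) (chartAt ℰ c).target := by
    intro i
    have hv : Continuous (fun y : ℰ => (⟨y, EuclideanSpace.single i (1 : ℝ)⟩ :
        TangentBundle (𝓡 n) ℰ)) := by
      have := (tangentBundleModelSpaceHomeomorph (𝓡 n) (H := ℰ)).symm.continuous
      exact this.comp (f := fun y : ℰ => ((y, EuclideanSpace.single i (1 : ℝ)) : ℰ × ℰ))
        (by fun_prop)
    refine (ht.comp hv.continuousOn fun y hy => hy).congr fun y hy => ?_
    simp only [Function.comp_apply, tangentMapWithin]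
    rw [mfderivWithin_of_isOpen (chartAt ℰ c).open_target hy]
  exact continuousOn_pi.2 fun i => continuousOn_pi.2 fun j => (hs i).inner_bundle (hs j)

end Continuity

/-! ### The local Poincaré inequality on the manifold -/

/-- Cauchy–Schwarz: `covectorInner` dominates the square of the operator norm. -/
theorem norm_apply_sq_le_covectorInner {T : Type*} [NormedAddCommGroup T] [InnerProductSpace ℝ T]
    [FiniteDimensional ℝ T] (α : T →L[ℝ] ℂ) (w : T) :
    ‖α w‖ ^ 2 ≤ ‖covectorInner α α‖ * ‖w‖ ^ 2 := by
  set e := stdOrthonormalBasis ℝ T with he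
  have h1 : ‖α w‖ ≤ ∑ i, ‖α (e i)‖ * ‖inner ℝ (e i) w‖ := by
    conv_lhs => rw [← e.sum_repr' w, map_sum]
    refine (norm_sum_le _ _).trans (Finset.sum_le_sum fun i _ => ?_)
    rw [map_smul, norm_smul, mul_comm]
  have h2 : ‖covectorInner α α‖ = ∑ i, ‖α (e i)‖ ^ 2 := by
    rw [covectorInner_self, Complex.norm_real, Real.norm_of_nonneg (by positivity)]
  rw [h2, ← e.sum_sq_norm_inner_right w]
  calc ‖α w‖ ^ 2 ≤ (∑ i, ‖α (e i)‖ * ‖inner ℝ (e i) w‖) ^ 2 := by gcongr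
    _ ≤ _ := Finset.sum_mul_sq_le_sq_mul_sq _ _ _

section Local

variable {n : ℕ} {M : Type*} [TopologicalSpace M] [ChartedSpace (EuclideanSpace ℝ (Fin n)) M]

local notation "ℰ" => EuclideanSpace ℝ (Fin n)

variable [IsManifold (𝓡 n) ∞ M] [RiemannianBundle (fun x : M => TangentSpace (𝓡 n) x)]

/-- The Euclidean gradient of `f` in a chart is controlled by `|df|²` and by the diagonal coefficients
`g_ii = |∂_i|²` of the metric, as `∂_i f = df(∂_i)`. -/
theorem norm_fderiv_comp_chart_symm_sq_le {c : M} {y : ℰ} (hy : y ∈ (chartAt ℰ c).target)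
    {L : ℝ} (hL : ∀ i, chartMetric n c y i i ≤ L) {f : M → ℂ}
    (hf : ContMDiff (𝓡 n) 𝓘(ℝ, ℂ) ∞ f) :
    ‖fderiv ℝ (f ∘ (chartAt ℰ c).symm) y‖ ^ 2 ≤ n ^ 2 * L *
      ‖covectorInner (differential n f ((chartAt ℰ c).symm y))
        (differential n f ((chartAt ℰ c).symm y))‖ := by
  set κ := ‖covectorInner (differential n f ((chartAt ℰ c).symm y))
        (differential n f ((chartAt ℰ c).symm y))‖ with hκ
  have hD : ∀ i : Fin n, ‖fderiv ℝ (f ∘ (chartAt ℰ c).symm) y (EuclideanSpace.single i 1)‖ ≤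
      √(L * κ) := by
    intro i
    have h1 := mfderiv_comp y (hf.mdifferentiableAt (by simp)) (mdifferentiableAt_chart_symm c hy)
    have h2 := DFunLike.congr_fun h1 (EuclideanSpace.single i (1 : ℝ))
    rw [mfderiv_eq_fderiv] at h2
    have h3 := norm_apply_sq_le_covectorInner (differential n f ((chartAt ℰ c).symm y))
      (mfderiv (𝓡 n) (𝓡 n) (chartAt ℰ c).symm y (EuclideanSpace.single i 1))
    have h4 : ‖(mfderiv (𝓡 n) (𝓡 n) (chartAt ℰ c).symm y (EuclideanSpace.single i 1) :
        TangentSpace (𝓡 n) ((chartAt ℰ c).symm y))‖ ^ 2 = chartMetric n c y i i :=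
      (real_inner_self_eq_norm_sq _).symm
    refine Real.le_sqrt_of_sq_le ?_
    calc _ = _ := congrArg (fun z : ℂ => ‖z‖ ^ 2) h2
      _ ≤ _ := h3
      _ = chartMetric n c y i i * κ := by rw [mul_comm]; exact congrArg (· * κ) h4
      _ ≤ L * κ := by
        exact mul_le_mul_of_nonneg_right (hL i) (norm_nonneg _)
  have hop : ‖fderiv ℝ (f ∘ (chartAt ℰ c).symm) y‖ ≤ n * √(L * κ) := by
    refine ContinuousLinearMap.opNorm_le_bound _ (by positivity) fun v => ?_
    have hv : v = ∑ i, v i • (EuclideanSpace.single i (1 : ℝ) : ℰ) := by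
      have := (EuclideanSpace.basisFun (Fin n) ℝ).sum_repr v
      simpa using this.symm
    conv_lhs => rw [hv, map_sum]
    calc _ ≤ ∑ i : Fin n, ‖v‖ * √(L * κ) := by
          refine (norm_sum_le _ _).trans (Finset.sum_le_sum fun i _ => ?_)
          rw [map_smul, norm_smul]
          gcongr
          · exact PiLp.norm_apply_le v i
          · exact hD i
      _ = n * √(L * κ) * ‖v‖ := by
          rw [Finset.sum_const, Finset.card_univ, Fintype.card_fin, nsmul_eq_mul]; ring
  -- for `n = 0` the bound `L` may be negative, and there are no derivatives
  rcases Nat.eq_zero_or_pos n with rfl | hn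
  · have h0 : ‖fderiv ℝ (f ∘ (chartAt (EuclideanSpace ℝ (Fin 0)) c).symm) y‖ = 0 := by
      refine le_antisymm (hop.trans (by simp)) (norm_nonneg _)
    rw [h0]; simp
  have hL0 : 0 ≤ L :=
    (real_inner_self_nonneg (F := TangentSpace (𝓡 n) ((chartAt ℰ c).symm y))).trans (hL ⟨0, hn⟩)
  calc _ ≤ (n * √(L * κ)) ^ 2 := by gcongr
    _ = n ^ 2 * L * κ := by
      rw [mul_pow, Real.sq_sqrt (by positivity), mul_assoc]

variable [MeasurableSpace M] [BorelSpace M]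

theorem restrict_riemannianVolume_le_smul_map (c : M) {B : Set ℰ} (hB : IsOpen B)
    (hBt : B ⊆ (chartAt ℰ c).target) {b : ℝ} (hb : ∀ y ∈ B, √(chartMetric n c y).det ≤ b) :
    (riemannianVolume n M).restrict ((chartAt ℰ c).source ∩ chartAt ℰ c ⁻¹' B) ≤
      ENNReal.ofReal b • (volume.restrict B).map (chartAt ℰ c).symm := by
  have hU : IsOpen ((chartAt ℰ c).source ∩ chartAt ℰ c ⁻¹' B) :=
    (chartAt ℰ c).isOpen_inter_preimage hB
  refine Measure.le_iff.2 fun s hs => ?_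
  have hsU := hs.inter hU.measurableSet
  have hψ : AEMeasurable (chartAt ℰ c).symm (volume.restrict B) :=
    ((chartAt ℰ c).continuousOn_symm.mono hBt).aemeasurable hB.measurableSet
  have hset : (chartAt ℰ c).target ∩ (chartAt ℰ c).symm ⁻¹'
      (s ∩ ((chartAt ℰ c).source ∩ chartAt ℰ c ⁻¹' B)) = (chartAt ℰ c).symm ⁻¹' s ∩ B := by
    ext y
    constructor
    · rintro ⟨hy, hys, -, hyB⟩
      rw [Set.mem_preimage, (chartAt ℰ c).right_inv hy] at hyB
      exact ⟨hys, hyB⟩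
    · rintro ⟨hys, hyB⟩
      refine ⟨hBt hyB, hys, (chartAt ℰ c).map_target (hBt hyB), ?_⟩
      rwa [Set.mem_preimage, (chartAt ℰ c).right_inv (hBt hyB)]
  have hm : MeasurableSet ((chartAt ℰ c).symm ⁻¹' s ∩ B) :=
    hset ▸ measurableSet_target_inter_preimage c hsU
  calc (riemannianVolume n M).restrict ((chartAt ℰ c).source ∩ chartAt ℰ c ⁻¹' B) s
      = (riemannianVolume n M).restrict (chartAt ℰ c).source
          (s ∩ ((chartAt ℰ c).source ∩ chartAt ℰ c ⁻¹' B)) := by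
        rw [Measure.restrict_apply hs, Measure.restrict_apply hsU,
          Set.inter_eq_left.2 (Set.inter_subset_right.trans Set.inter_subset_left)]
    _ ≤ chartVolume n c (s ∩ ((chartAt ℰ c).source ∩ chartAt ℰ c ⁻¹' B)) :=
        Measure.le_iff'.1 (restrict_riemannianVolume_le c) _
    _ = ∫⁻ y in (chartAt ℰ c).symm ⁻¹' s ∩ B, ENNReal.ofReal √(chartMetric n c y).det := by
        rw [chartVolume_apply c hsU, hset]
    _ ≤ ∫⁻ y in (chartAt ℰ c).symm ⁻¹' s ∩ B, ENNReal.ofReal b :=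
        setLIntegral_mono' hm fun y hy => ENNReal.ofReal_le_ofReal (hb y hy.2)
    _ = _ := by
        rw [setLIntegral_const, Measure.smul_apply, smul_eq_mul,
          Measure.map_apply_of_aemeasurable hψ hs, Measure.restrict_apply' hB.measurableSet]

omit [IsManifold (𝓡 n) ∞ M] in
theorem smul_map_le_riemannianVolume (c : M) {B : Set ℰ} (hB : IsOpen B)
    (hBt : B ⊆ (chartAt ℰ c).target) {a : ℝ} (ha : ∀ y ∈ B, a ≤ √(chartMetric n c y).det) :
    ENNReal.ofReal a • (volume.restrict B).map (chartAt ℰ c).symm ≤ riemannianVolume n M := by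
  refine Measure.le_iff.2 fun s hs => ?_
  have hψ : AEMeasurable (chartAt ℰ c).symm (volume.restrict B) :=
    ((chartAt ℰ c).continuousOn_symm.mono hBt).aemeasurable hB.measurableSet
  have hm : MeasurableSet ((chartAt ℰ c).symm ⁻¹' s ∩ B) := by
    have := (measurableSet_target_inter_preimage c hs).inter hB.measurableSet
    rwa [Set.inter_right_comm, Set.inter_eq_right.2 hBt, Set.inter_comm] at this
  calc _ = ∫⁻ y in (chartAt ℰ c).symm ⁻¹' s ∩ B, ENNReal.ofReal a := by
        rw [setLIntegral_const, Measure.smul_apply, smul_eq_mul,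
          Measure.map_apply_of_aemeasurable hψ hs, Measure.restrict_apply' hB.measurableSet]
    _ ≤ ∫⁻ y in (chartAt ℰ c).symm ⁻¹' s ∩ B, ENNReal.ofReal √(chartMetric n c y).det :=
        setLIntegral_mono' hm fun y hy => ENNReal.ofReal_le_ofReal (ha y hy.2)
    _ ≤ chartVolume n c s := by
        rw [chartVolume_apply c hs]
        exact lintegral_mono_set fun y hy => ⟨hBt hy.2, hy.1⟩
    _ ≤ riemannianVolume n M s := Measure.le_iff'.1 (chartVolume_le_riemannianVolume c) _

variable [IsContMDiffRiemannianBundle (𝓡 n) ∞ (EuclideanSpace ℝ (Fin n))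
    (fun x : M => TangentSpace (𝓡 n) x)]

omit [MeasurableSpace M] [BorelSpace M] in
/-- On a small ball in a chart, the metric and the density of the volume are bounded, and this
density is bounded below. -/
theorem exists_ball_chartMetric_bounds (p : M) :
    ∃ r > 0, ∃ a > 0, ∃ b L : ℝ, Metric.ball (chartAt ℰ p p) r ⊆ (chartAt ℰ p).target ∧
      ∀ y ∈ Metric.ball (chartAt ℰ p p) r, a ≤ √(chartMetric n p y).det ∧
        √(chartMetric n p y).det ≤ b ∧ ∀ i, chartMetric n p y i i ≤ L := by
  have hp : chartAt ℰ p p ∈ (chartAt ℰ p).target :=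
    (chartAt ℰ p).map_source (mem_chart_source _ p)
  have hnhds := (chartAt ℰ p).open_target.mem_nhds hp
  have hG : ContinuousAt (chartMetric n p) (chartAt ℰ p p) :=
    (continuousOn_chartMetric p).continuousAt hnhds
  have hdet : ContinuousAt (fun y => √(chartMetric n p y).det) (chartAt ℰ p p) :=
    ((continuous_id.matrix_det.continuousAt).comp hG).sqrt
  have hpos : 0 < √(chartMetric n p (chartAt ℰ p p)).det :=
    Real.sqrt_pos.2 (det_chartMetric_pos p hp)
  -- the diagonal coefficients are nonnegative, hence bounded by the trace
  have htr : ContinuousAt (fun y => (chartMetric n p y).trace) (chartAt ℰ p p) :=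
    (continuous_id.matrix_trace.continuousAt).comp hG
  have h1 := hdet.eventually (lt_mem_nhds (half_lt_self hpos))
  have h2 := hdet.eventually (gt_mem_nhds (lt_add_one _))
  have h3 := htr.eventually (gt_mem_nhds (lt_add_one _))
  obtain ⟨r, hr, h⟩ := Metric.eventually_nhds_iff_ball.1
    (h1.and (h2.and (h3.and (Filter.eventually_of_mem hnhds fun y hy => hy))))
  refine ⟨r, hr, _, half_pos hpos, _, (chartMetric n p (chartAt ℰ p p)).trace + 1, fun y hy => (h y hy).2.2.2, fun y hy =>
    ⟨(h y hy).1.le, (h y hy).2.1.le, fun i => ?_⟩⟩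
  refine le_trans ?_ (h y hy).2.2.1.le
  exact Finset.single_le_sum (f := fun i => chartMetric n p y i i) (fun j _ =>
    real_inner_self_nonneg (F := TangentSpace (𝓡 n) ((chartAt ℰ p).symm y))) (Finset.mem_univ i)

/-- Every point has a neighbourhood of finite volume on which a Poincaré–Wirtinger inequality
holds. -/
theorem exists_nhds_poincare (p : M) :
    ∃ U : Set M, IsOpen U ∧ p ∈ U ∧ riemannianVolume n M U ≠ ⊤ ∧ ∃ K : ENNReal, K ≠ ⊤ ∧
      ∀ f : M → ℂ, ContMDiff (𝓡 n) 𝓘(ℝ, ℂ) ∞ f →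
        ∫⁻ x in U, ∫⁻ y in U, ‖f x - f y‖ₑ ^ 2 ∂(riemannianVolume n M) ∂(riemannianVolume n M) ≤
          K * ∫⁻ x, ‖covectorInner (differential n f x) (differential n f x)‖ₑ
            ∂(riemannianVolume n M) := by
  obtain ⟨r, hr, a, ha, b, L, hBt, hB⟩ := exists_ball_chartMetric_bounds (n := n) p
  set B := Metric.ball (chartAt ℰ p p) r with hBdef
  set ψ := (chartAt ℰ p).symm with hψ
  have hBo : IsOpen B := Metric.isOpen_ball
  have hBv : volume B ≠ ⊤ := measure_ball_lt_top.ne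
  have hup := restrict_riemannianVolume_le_smul_map p hBo hBt fun y hy => (hB y hy).2.1
  have hlow := smul_map_le_riemannianVolume p hBo hBt fun y hy => (hB y hy).1
  set U := (chartAt ℰ p).source ∩ chartAt ℰ p ⁻¹' B with hU
  set μ := riemannianVolume n M with hμ
  have hupI : ∀ h : M → ENNReal, ∫⁻ x in U, h x ∂μ ≤ ENNReal.ofReal b * ∫⁻ y in B, h (ψ y) := by
    intro h
    refine (lintegral_mono' hup le_rfl).trans ?_
    rw [lintegral_smul_measure, smul_eq_mul]
    gcongr
    exact lintegral_map_le _ _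
  have hlowI : ∀ h : M → ENNReal, Measurable h →
      ∫⁻ y in B, h (ψ y) ≤ (ENNReal.ofReal a)⁻¹ * ∫⁻ x, h x ∂μ := by
    intro h hh
    have h1 : ENNReal.ofReal a * ∫⁻ y in B, h (ψ y) ≤ ∫⁻ x, h x ∂μ := by
      refine le_trans (le_of_eq ?_) (lintegral_mono' hlow le_rfl)
      rw [lintegral_smul_measure, smul_eq_mul, lintegral_map' hh.aemeasurable
        (((chartAt ℰ p).continuousOn_symm.mono hBt).aemeasurable hBo.measurableSet)]
    have ha0 : ENNReal.ofReal a ≠ 0 := (ENNReal.ofReal_pos.2 ha).ne'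
    calc ∫⁻ y in B, h (ψ y)
        = (ENNReal.ofReal a)⁻¹ * (ENNReal.ofReal a * ∫⁻ y in B, h (ψ y)) := by
          rw [← mul_assoc, ENNReal.inv_mul_cancel ha0 ENNReal.ofReal_ne_top, one_mul]
      _ ≤ _ := by gcongr
  refine ⟨U, (chartAt ℰ p).isOpen_inter_preimage hBo, ⟨mem_chart_source _ p,
    Metric.mem_ball_self hr⟩, ?_, ENNReal.ofReal b * ENNReal.ofReal b *
      (4 * ENNReal.ofReal (2 * r) ^ 2 * volume B * 2 ^ Module.finrank ℝ ℰ) *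
      (ENNReal.ofReal (n ^ 2 * L) * (ENNReal.ofReal a)⁻¹), ?_, fun f hf => ?_⟩
  · have := hupI fun _ => 1
    simp only [lintegral_const, Measure.restrict_apply_univ, one_mul] at this
    exact ne_top_of_le_ne_top (ENNReal.mul_ne_top ENNReal.ofReal_ne_top hBv) this
  · have : (ENNReal.ofReal a)⁻¹ ≠ ⊤ := ENNReal.inv_ne_top.2 (ENNReal.ofReal_pos.2 ha).ne'
    finiteness
  set κ : M → ENNReal := fun x => ‖covectorInner (differential n f x) (differential n f x)‖ₑ
  have hκ : Measurable κ := (continuous_covectorInner_differential hf hf).enorm.measurable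
  set F := f ∘ ψ
  have hF : ContDiffOn ℝ 1 F B := by
    have h1 : ContMDiffOn (𝓡 n) (𝓡 n) ∞ ψ (chartAt ℰ p).target := contMDiffOn_chart_symm
    have h2 := (hf.comp_contMDiffOn h1).contDiffOn
    exact (h2.of_le (by norm_cast)).mono hBt
  have hd : ∀ x ∈ B, ∀ y ∈ B, ‖y - x‖ₑ ≤ ENNReal.ofReal (2 * r) := by
    intro x hx y hy
    rw [← ofReal_norm, ← dist_eq_norm]
    refine ENNReal.ofReal_le_ofReal ?_
    have := dist_triangle_right y x (chartAt ℰ p p)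
    rw [hBdef, Metric.mem_ball] at hx hy
    linarith
  have hE := lintegral_lintegral_enorm_sub_sq_le (volume : Measure ℰ) hBo
    (convex_ball _ _) hd hF
  have hFκ : ∀ y ∈ B, ‖fderiv ℝ F y‖ₑ ^ 2 ≤ ENNReal.ofReal (n ^ 2 * L) * κ (ψ y) := by
    intro y hy
    have h := norm_fderiv_comp_chart_symm_sq_le (hBt hy) (hB y hy).2.2 hf
    have h1 := ENNReal.ofReal_le_ofReal h
    rwa [ENNReal.ofReal_pow (norm_nonneg _), ENNReal.ofReal_mul' (norm_nonneg _),
      ofReal_norm, ofReal_norm] at h1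
  calc ∫⁻ x in U, ∫⁻ y in U, ‖f x - f y‖ₑ ^ 2 ∂μ ∂μ
      ≤ ∫⁻ x in U, ENNReal.ofReal b * (∫⁻ y in B, ‖f x - F y‖ₑ ^ 2) ∂μ :=
        lintegral_mono fun x => hupI _
    _ ≤ ENNReal.ofReal b * ∫⁻ x in B, ENNReal.ofReal b * ∫⁻ y in B, ‖F x - F y‖ₑ ^ 2 := hupI _
    _ = ENNReal.ofReal b * ENNReal.ofReal b * ∫⁻ x in B, ∫⁻ y in B, ‖F x - F y‖ₑ ^ 2 := by
        rw [lintegral_const_mul' _ _ ENNReal.ofReal_ne_top, mul_assoc]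
    _ ≤ ENNReal.ofReal b * ENNReal.ofReal b *
        (4 * ENNReal.ofReal (2 * r) ^ 2 * volume B * 2 ^ Module.finrank ℝ ℰ *
          (ENNReal.ofReal (n ^ 2 * L) * ((ENNReal.ofReal a)⁻¹ * ∫⁻ x, κ x ∂μ))) := by
        gcongr
        refine hE.trans ?_
        gcongr
        calc ∫⁻ x in B, ‖fderiv ℝ F x‖ₑ ^ 2
            ≤ ∫⁻ x in B, ENNReal.ofReal (n ^ 2 * L) * κ (ψ x) :=
              setLIntegral_mono' hBo.measurableSet hFκ
          _ = ENNReal.ofReal (n ^ 2 * L) * ∫⁻ x in B, κ (ψ x) :=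
              lintegral_const_mul' _ _ ENNReal.ofReal_ne_top
          _ ≤ _ := by gcongr; exact hlowI κ hκ
    _ = _ := by ring

end Local

/-! ### Poincaré inequalities from a finite rank correction -/

/-- If `‖T f‖² ≤ K (q f + ‖A (T f)‖²)` for the quadratic form `q f = ‖f‖² - ‖T f‖²` and an operator
`A` of finite rank, then `‖T f‖² ≤ C² q f` on every closed subspace on which `q` vanishes only at
`0`. Otherwise there are `g k` in the subspace with `‖T (g k)‖ = 1` and `q (g k) → 0`; along a
subsequence `A (T (g k))` converges, so that `g k` is a Cauchy sequence, whose limit is a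
nonzero zero of `q`. -/
theorem exists_poincare_of_finite_rank {H L F : Type*} [NormedAddCommGroup H]
    [InnerProductSpace ℂ H] [CompleteSpace H] [NormedAddCommGroup L] [InnerProductSpace ℂ L]
    [NormedAddCommGroup F] [NormedSpace ℂ F] [ProperSpace F] (T : H →L[ℂ] L) (A : L →L[ℂ] F)
    (hq : ∀ f, ‖T f‖ ^ 2 ≤ ‖f‖ ^ 2) {K : ℝ} (hK0 : 0 ≤ K)
    (hK : ∀ f, ‖T f‖ ^ 2 ≤ K * (‖f‖ ^ 2 - ‖T f‖ ^ 2 + ‖A (T f)‖ ^ 2))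
    (V : Submodule ℂ H) (hVc : IsClosed (V : Set H))
    (hV : ∀ f ∈ V, ‖f‖ ^ 2 - ‖T f‖ ^ 2 = 0 → f = 0) :
    ∃ C : ℝ, 0 < C ∧ ∀ f ∈ V, ‖T f‖ ^ 2 ≤ C ^ 2 * (‖f‖ ^ 2 - ‖T f‖ ^ 2) := by
  by_contra! hcon
  have hseq : ∀ k : ℕ, ∃ g ∈ V, ‖T g‖ = 1 ∧ ‖g‖ ^ 2 - ‖T g‖ ^ 2 ≤ 1 / ((k : ℝ) + 1) := by
    intro k
    obtain ⟨f, hfV, hf⟩ := hcon (k + 1) (by positivity)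
    have hq0 := sub_nonneg.2 (hq f)
    have hTf : 0 < ‖T f‖ := by
      by_contra! h0
      have : ‖T f‖ = 0 := le_antisymm h0 (norm_nonneg _)
      rw [this] at hf hq0
      nlinarith [mul_nonneg (sq_nonneg ((k : ℝ) + 1)) hq0]
    set c : ℂ := ((‖T f‖⁻¹ : ℝ) : ℂ) with hc
    have hcn : ‖c‖ = ‖T f‖⁻¹ := by
      rw [hc, Complex.norm_real, Real.norm_of_nonneg (by positivity)]
    have h1 : ‖T (c • f)‖ = 1 := by
      rw [map_smul, norm_smul, hcn, inv_mul_cancel₀ hTf.ne']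
    refine ⟨c • f, V.smul_mem c hfV, h1, ?_⟩
    have h2 : ‖c • f‖ ^ 2 - ‖T (c • f)‖ ^ 2 = (‖f‖ ^ 2 - ‖T f‖ ^ 2) / ‖T f‖ ^ 2 := by
      rw [map_smul, norm_smul, norm_smul, hcn]
      field_simp
    rw [h2, div_le_div_iff₀ (by positivity) (by positivity)]
    have hk1 : (1 : ℝ) ≤ (k : ℝ) + 1 := by linarith [(Nat.cast_nonneg k : (0 : ℝ) ≤ k)]
    nlinarith [mul_nonneg (mul_nonneg hq0 (by linarith : (0 : ℝ) ≤ (k : ℝ) + 1))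
      (sub_nonneg.2 hk1)]
  choose g hgV hg1 hgq using hseq
  have hbdd : Bornology.IsBounded (Set.range fun k => A (T (g k))) := by
    refine isBounded_iff_forall_norm_le.2 ⟨‖A‖, ?_⟩
    rintro _ ⟨k, rfl⟩
    simpa [hg1 k] using A.le_opNorm (T (g k))
  obtain ⟨z, -, φ, hφ, hz⟩ := tendsto_subseq_of_bounded hbdd (fun k => Set.mem_range_self k)
  have hpar : ∀ a b : H, ‖a - b‖ ^ 2 - ‖T (a - b)‖ ^ 2 ≤
      2 * (‖a‖ ^ 2 - ‖T a‖ ^ 2) + 2 * (‖b‖ ^ 2 - ‖T b‖ ^ 2) := by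
    intro a b
    have h1 := parallelogram_law_with_norm ℂ a b
    have h2 := parallelogram_law_with_norm ℂ (T a) (T b)
    have h3 := hq (a + b)
    rw [map_add] at h3
    rw [map_sub]
    nlinarith
  have hqlim : Filter.Tendsto (fun k => ‖g (φ k)‖ ^ 2 - ‖T (g (φ k))‖ ^ 2) Filter.atTop
      (nhds 0) := by
    refine squeeze_zero (fun k => sub_nonneg.2 (hq _)) (fun k => hgq (φ k)) ?_
    exact (tendsto_one_div_add_atTop_nhds_zero_nat (𝕜 := ℝ)).comp hφ.tendsto_atTop
  have hcauchy : CauchySeq (fun k => g (φ k)) := by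
    refine Metric.cauchySeq_iff.2 fun ε hε => ?_
    have hη : 0 < ε ^ 2 / (10 * (1 + K)) := by positivity
    have e1 := hqlim.eventually (gt_mem_nhds hη)
    obtain ⟨N1, hN1⟩ := Filter.eventually_atTop.1 e1
    obtain ⟨N2, hN2⟩ := Metric.cauchySeq_iff.1 hz.cauchySeq (√(ε ^ 2 / (10 * (1 + K))))
      (Real.sqrt_pos.2 hη)
    refine ⟨max N1 N2, fun j hj k hk => ?_⟩
    have hj1 := hN1 j ((le_max_left _ _).trans hj)
    have hk1 := hN1 k ((le_max_left _ _).trans hk)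
    have hjk := hN2 j ((le_max_right _ _).trans hj) k ((le_max_right _ _).trans hk)
    set η := ε ^ 2 / (10 * (1 + K)) with hηdef
    have hA : ‖A (T (g (φ j) - g (φ k)))‖ ^ 2 ≤ η := by
      rw [map_sub, map_sub, ← dist_eq_norm]
      calc _ ≤ √η ^ 2 := by gcongr; exact hjk.le
        _ = η := Real.sq_sqrt hη.le
    have hp := hpar (g (φ j)) (g (φ k))
    have hKK := hK (g (φ j) - g (φ k))
    have hfin : ‖g (φ j) - g (φ k)‖ ^ 2 < ε ^ 2 := by
      have hs : ‖g (φ j) - g (φ k)‖ ^ 2 - ‖T (g (φ j) - g (φ k))‖ ^ 2 +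
          ‖A (T (g (φ j) - g (φ k)))‖ ^ 2 ≤ 5 * η := by linarith
      have h1 := mul_le_mul_of_nonneg_left hs hK0
      have h2 : η * (10 * (1 + K)) = ε ^ 2 := div_mul_cancel₀ _ (by positivity)
      nlinarith [sq_nonneg ‖A (T (g (φ j) - g (φ k)))‖, sq_pos_of_pos hε]
    rw [dist_eq_norm]
    exact lt_of_pow_lt_pow_left₀ 2 hε.le hfin
  obtain ⟨g₀, hg₀⟩ := cauchySeq_tendsto_of_complete hcauchy
  have hg₀V : g₀ ∈ V := hVc.mem_of_tendsto hg₀ (Filter.Eventually.of_forall fun k => hgV _)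
  have hT₀ : Filter.Tendsto (fun k => ‖T (g (φ k))‖) Filter.atTop (nhds ‖T g₀‖) :=
    ((T.continuous.tendsto g₀).comp hg₀).norm
  have hq₀ : ‖g₀‖ ^ 2 - ‖T g₀‖ ^ 2 = 0 :=
    tendsto_nhds_unique ((hg₀.norm.pow 2).sub (hT₀.pow 2)) hqlim
  have hT1 : ‖T g₀‖ = 1 :=
    tendsto_nhds_unique hT₀ (by simp only [hg1]; exact tendsto_const_nhds)
  rw [hV g₀ hg₀V hq₀] at hT1
  simp at hT1

/-- The variance of `f` as a double integral. -/
theorem lintegral_lintegral_enorm_sub_sq_eq {α : Type*} [MeasurableSpace α] (ν : Measure α)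
    [IsFiniteMeasure ν] {f : α → ℂ} (hf : MemLp f 2 ν) :
    ∫⁻ x, ∫⁻ y, ‖f x - f y‖ₑ ^ 2 ∂ν ∂ν =
      ENNReal.ofReal (2 * (ν.real Set.univ * ∫ x, ‖f x‖ ^ 2 ∂ν - ‖∫ x, f x ∂ν‖ ^ 2)) := by
  have hf1 : Integrable f ν := hf.integrable (by norm_num)
  have hf2 : Integrable (fun x => ‖f x‖ ^ 2) ν := hf.integrable_norm_pow (by norm_num)
  set S := ∫ x, ‖f x‖ ^ 2 ∂ν
  set I := ∫ x, f x ∂ν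
  have hin : ∀ c : ℂ, Integrable (fun x => inner ℝ c (f x)) ν := fun c => hf1.const_inner c
  have hconv : ∀ (h : α → ℂ), Integrable (fun x => ‖h x‖ ^ 2) ν →
      ∫⁻ x, ‖h x‖ₑ ^ 2 ∂ν = ENNReal.ofReal (∫ x, ‖h x‖ ^ 2 ∂ν) := by
    intro h hh
    rw [ofReal_integral_eq_lintegral_ofReal hh (Filter.Eventually.of_forall fun x => sq_nonneg _)]
    refine lintegral_congr fun x => ?_
    rw [ENNReal.ofReal_pow (norm_nonneg _), ofReal_norm]
  have hreal : ∀ x, ∫ y, ‖f x - f y‖ ^ 2 ∂ν =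
      ν.real Set.univ * ‖f x‖ ^ 2 - 2 * inner ℝ I (f x) + S := by
    intro x
    have i1 : Integrable (fun y => ‖f x‖ ^ 2 - 2 * inner ℝ (f x) (f y)) ν :=
      (integrable_const _).sub ((hin _).const_mul 2)
    simp only [norm_sub_sq_real]
    rw [integral_add i1 hf2, integral_sub (integrable_const _) ((hin _).const_mul 2),
      integral_const, integral_const_mul, integral_inner hf1, smul_eq_mul, real_inner_comm]
  have hinner : ∀ x, ∫⁻ y, ‖f x - f y‖ₑ ^ 2 ∂ν =
      ENNReal.ofReal (ν.real Set.univ * ‖f x‖ ^ 2 - 2 * inner ℝ I (f x) + S) := by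
    intro x
    have i1 : Integrable (fun y => ‖f x - f y‖ ^ 2) ν :=
      ((memLp_const (f x)).sub hf).integrable_norm_pow (by norm_num)
    rw [hconv (fun y => f x - f y) i1, hreal]
  simp only [hinner]
  have i1 : Integrable (fun x => ν.real Set.univ * ‖f x‖ ^ 2) ν := hf2.const_mul _
  have i2 : Integrable (fun x => 2 * inner ℝ I (f x)) ν := (hin I).const_mul 2
  have i3 : Integrable (fun x => ν.real Set.univ * ‖f x‖ ^ 2 - 2 * inner ℝ I (f x)) ν := i1.sub i2
  rw [← ofReal_integral_eq_lintegral_ofReal (by exact i3.add (integrable_const _))]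
  · congr 1
    rw [integral_add i3 (integrable_const _), integral_sub i1 i2, integral_const_mul,
      integral_const_mul, integral_const, integral_inner hf1, real_inner_self_eq_norm_sq,
      smul_eq_mul]
    ring
  · refine Filter.Eventually.of_forall fun x => ?_
    simp only [Pi.zero_apply]
    rw [← hreal]
    exact integral_nonneg fun y => sq_nonneg _

section Sobolev

variable {n : ℕ} {M : Type*} [TopologicalSpace M] [ChartedSpace (EuclideanSpace ℝ (Fin n)) M]
  [RiemannianBundle (fun x : M => TangentSpace (𝓡 n) x)] [IsManifold (𝓡 n) ∞ M]
  [IsContMDiffRiemannianBundle (𝓡 n) ∞ (EuclideanSpace ℝ (Fin n))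
    (fun x : M => TangentSpace (𝓡 n) x)]
  [MeasurableSpace M] [BorelSpace M]

/-! ### The Dirichlet form on `H¹` -/

theorem norm_toL2_le (f : H1 n M) : ‖toL2 n M f‖ ≤ ‖f‖ := by
  induction f using Completion.induction_on with
  | hp => exact isClosed_le (toL2 n M).continuous.norm continuous_norm
  | ih f =>
    rw [toL2_coe, Completion.norm_coe]
    exact (norm_smoothToL2Linear_le n M f).trans_eq (one_mul _)

theorem gradNormSq_eq (f : H1 n M) : gradNormSq f = ‖f‖ ^ 2 - ‖toL2 n M f‖ ^ 2 := by
  rw [gradNormSq, dirichlet, Complex.sub_re, @norm_sq_eq_re_inner ℂ, @norm_sq_eq_re_inner ℂ]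
  rfl

theorem gradNormSq_nonneg (f : H1 n M) : 0 ≤ gradNormSq f := by
  rw [gradNormSq_eq, sub_nonneg]
  exact pow_le_pow_left₀ (norm_nonneg _) (norm_toL2_le f) 2

theorem dirichlet_conj_symm (f h : H1 n M) : conj (dirichlet f h) = dirichlet h f := by
  simp only [dirichlet, map_sub, inner_conj_symm]

variable (n M) in
/-- The Dirichlet form as a positive semidefinite Hermitian form. -/
@[reducible] noncomputable def dirichletCore : PreInnerProductSpace.Core ℂ (H1 n M) where
  inner f h := dirichlet f h
  conj_inner_symm f h := dirichlet_conj_symm h f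
  re_inner_nonneg f := gradNormSq_nonneg f
  add_left f f' h := by simp only [dirichlet, map_add, inner_add_left]; ring
  smul_left f h a := by simp only [dirichlet, map_smul, inner_smul_left]; ring

/-- By the Cauchy–Schwarz inequality for the Dirichlet form, `∇ f = 0` makes `f` a weak solution of
`Δ f = 0`. -/
theorem mem_kerLaplacian_of_gradNormSq_eq_zero {f : H1 n M} (hf : gradNormSq f = 0) :
    f ∈ kerLaplacian n M := by
  intro φ
  have h := @InnerProductSpace.Core.inner_mul_inner_self_le ℂ (H1 n M) _ _ _ (dirichletCore n M) φ f
  change ‖dirichlet φ f‖ * ‖dirichlet f φ‖ ≤ gradNormSq φ * gradNormSq f at h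
  rw [hf, mul_zero, ← dirichlet_conj_symm φ f, RCLike.norm_conj] at h
  exact norm_eq_zero.1 (mul_self_eq_zero.1 (le_antisymm h (mul_self_nonneg _)))

variable (n M) in
theorem isClosed_kerLaplacian : IsClosed (kerLaplacian n M : Set (H1 n M)) := by
  have : (kerLaplacian n M : Set (H1 n M)) = ⋂ φ : H1 n M, {h | dirichlet φ h = 0} := by
    ext h; simp [kerLaplacian]
  rw [this]
  refine isClosed_iInter fun φ => isClosed_eq ?_ continuous_const
  change Continuous fun h => inner ℂ φ h - inner ℂ (toL2 n M φ) (toL2 n M h)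
  fun_prop

/-! ### Existence of a Poincaré constant -/

theorem gradNormSq_coe (f : SmoothH1 n M) : gradNormSq (f : H1 n M) =
    ∫ x, ‖covectorInner (differential n f.fn x) (differential n f.fn x)‖
      ∂(riemannianVolume n M) := by
  rw [gradNormSq, dirichlet_coe]
  have : ∀ x, covectorInner (differential n f.fn x) (differential n f.fn x) =
      ((‖covectorInner (differential n f.fn x) (differential n f.fn x)‖ : ℝ) : ℂ) := fun x => by
    rw [covectorInner_self, Complex.norm_real, Real.norm_of_nonneg (by positivity)]
  rw [integral_congr_ae (Filter.Eventually.of_forall this), integral_complex_ofReal,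
    Complex.ofReal_re]

theorem norm_sq_toL2_coe (f : SmoothH1 n M) :
    ‖toL2 n M (f : H1 n M)‖ ^ 2 = ∫ x, ‖f.fn x‖ ^ 2 ∂(riemannianVolume n M) := by
  rw [toL2_coe, @norm_sq_eq_re_inner ℂ]
  have := inner_smoothToL2Linear n M f f
  change RCLike.re (inner ℂ (smoothToL2Linear n M f) (smoothToL2Linear n M f)) = _
  rw [this]
  simp only [Complex.conj_mul', ← Complex.ofReal_pow, integral_complex_ofReal]
  simp

/-- The local Poincaré–Wirtinger inequality, with the mean value written as the inner product
with an element of `L²`. -/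
theorem exists_nhds_poincare_inner (p : M) :
    ∃ U : Set M, IsOpen U ∧ p ∈ U ∧ ∃ (w : L2 n M) (K : ℝ), 0 ≤ K ∧ ∀ f : SmoothH1 n M,
      ∫ x in U, ‖f.fn x‖ ^ 2 ∂(riemannianVolume n M) ≤
        K * (gradNormSq (f : H1 n M) + ‖inner ℂ w (toL2 n M (f : H1 n M))‖ ^ 2) := by
  obtain ⟨U, hU, hpU, hUμ, K, hK, hpoinc⟩ := exists_nhds_poincare (n := n) p
  set μ := riemannianVolume n M with hμ
  set V := μ.real U with hV
  have hfin : IsFiniteMeasure (μ.restrict U) := ⟨by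
    rw [Measure.restrict_apply_univ]; exact hUμ.lt_top⟩
  refine ⟨U, hU, hpU, indicatorConstLp 2 hU.measurableSet hUμ (1 : ℂ), V⁻¹ * (K.toReal / 2 + 1),
    by positivity, fun f => ?_⟩
  have hint : inner ℂ (indicatorConstLp 2 hU.measurableSet hUμ (1 : ℂ))
      (toL2 n M (f : H1 n M)) = ∫ x in U, f.fn x ∂μ := by
    rw [L2.inner_indicatorConstLp_one, toL2_coe]
    exact integral_congr_ae (ae_restrict_of_ae f.memLp.coeFn_toLp)
  rw [hint]
  have h1 := lintegral_lintegral_enorm_sub_sq_eq (μ.restrict U) (f.memLp.restrict U)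
  have h2 := hpoinc f.fn f.contMDiff
  have h3 : ∫⁻ x, ‖covectorInner (differential n f.fn x) (differential n f.fn x)‖ₑ ∂μ =
      ENNReal.ofReal (gradNormSq (f : H1 n M)) := by
    rw [gradNormSq_coe, ofReal_integral_norm_eq_lintegral_enorm (f.integrable f)]
  have hg := gradNormSq_nonneg (f : H1 n M)
  rw [h1, h3, ← ENNReal.ofReal_toReal hK, ← ENNReal.ofReal_mul ENNReal.toReal_nonneg,
    ENNReal.ofReal_le_ofReal_iff (by positivity), measureReal_restrict_apply_univ] at h2
  -- if `U` has volume `0`, the factor `V⁻¹` in the constant is `0`, and so are all the integrals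
  rcases eq_or_lt_of_le (measureReal_nonneg : 0 ≤ V) with h0 | h0
  · have : μ.restrict U = 0 := by
      rw [Measure.restrict_eq_zero]
      exact (measureReal_eq_zero_iff hUμ).1 h0.symm
    rw [this, integral_zero_measure, integral_zero_measure]
    positivity
  · rw [mul_assoc, ← div_eq_inv_mul, le_div_iff₀ h0]
    have h5 := sq_nonneg ‖∫ x in U, f.fn x ∂μ‖
    have h6 : 0 ≤ K.toReal * ‖∫ x in U, f.fn x ∂μ‖ ^ 2 := by positivity
    nlinarith

variable (n M) in
/-- A Poincaré inequality on `H¹(M)`, up to finitely many inner products with elements of `L²`. -/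
theorem exists_finite_rank_poincare [CompactSpace M] :
    ∃ (t : Finset M) (w : M → L2 n M) (K : ℝ), 0 ≤ K ∧ ∀ f : H1 n M,
      ‖toL2 n M f‖ ^ 2 ≤ K * (gradNormSq f +
        ‖ContinuousLinearMap.pi (fun i : t => innerSL ℂ (w i)) (toL2 n M f)‖ ^ 2) := by
  choose U hUo hpU w K hK0 hK using exists_nhds_poincare_inner (n := n) (M := M)
  obtain ⟨t, ht⟩ := CompactSpace.elim_nhds_subcover U fun p => (hUo p).mem_nhds (hpU p)
  refine ⟨t, w, ∑ p ∈ t, K p, Finset.sum_nonneg fun p _ => hK0 p, fun f => ?_⟩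
  induction f using Completion.induction_on with
  | hp =>
    simp only [gradNormSq_eq]
    refine isClosed_le ?_ ?_ <;> fun_prop
  | ih f =>
    set μ := riemannianVolume n M with hμ
    have hint : Integrable (fun x => ‖f.fn x‖ ^ 2) μ := f.memLp.integrable_norm_pow (by norm_num)
    have hcover : ∀ x, ‖f.fn x‖ ^ 2 ≤ ∑ p ∈ t, (U p).indicator (fun x => ‖f.fn x‖ ^ 2) x := by
      intro x
      have hx : x ∈ ⋃ p ∈ t, U p := by rw [ht]; trivial
      obtain ⟨p, hp, hxp⟩ := Set.mem_iUnion₂.1 hx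
      calc ‖f.fn x‖ ^ 2 = (U p).indicator (fun x => ‖f.fn x‖ ^ 2) x :=
            (Set.indicator_of_mem hxp fun x => ‖f.fn x‖ ^ 2).symm
        _ ≤ _ := Finset.single_le_sum
            (f := fun p => (U p).indicator (fun x => ‖f.fn x‖ ^ 2) x)
            (fun q _ => Set.indicator_nonneg (fun y _ => sq_nonneg _) x) hp
    have hindi : ∀ p, Integrable ((U p).indicator fun x => ‖f.fn x‖ ^ 2) μ :=
      fun p => hint.indicator (hUo p).measurableSet
    rw [norm_sq_toL2_coe]
    calc ∫ x, ‖f.fn x‖ ^ 2 ∂μ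
        ≤ ∫ x, ∑ p ∈ t, (U p).indicator (fun x => ‖f.fn x‖ ^ 2) x ∂μ :=
          integral_mono hint (integrable_finsetSum _ fun p _ => hindi p) hcover
      _ = ∑ p ∈ t, ∫ x in U p, ‖f.fn x‖ ^ 2 ∂μ := by
          rw [integral_finsetSum _ fun p _ => hindi p]
          exact Finset.sum_congr rfl fun p _ => integral_indicator (hUo p).measurableSet
      _ ≤ ∑ p ∈ t, K p * (gradNormSq (f : H1 n M) + ‖ContinuousLinearMap.pi
            (fun i : t => innerSL ℂ (w i)) (toL2 n M (f : H1 n M))‖ ^ 2) := by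
          refine Finset.sum_le_sum fun p hp => (hK p f).trans ?_
          have := hK0 p
          gcongr
          exact norm_le_pi_norm (ContinuousLinearMap.pi (fun i : t => innerSL ℂ (w i))
            (toL2 n M (f : H1 n M))) ⟨p, hp⟩
      _ = _ := by rw [Finset.sum_mul]

variable (n M) in
theorem exists_isPoincareConstant [CompactSpace M] : ∃ C : ℝ, IsPoincareConstant n M C := by
  obtain ⟨t, w, K, hK0, hK⟩ := exists_finite_rank_poincare n M
  obtain ⟨C, hC, h⟩ := exists_poincare_of_finite_rank (toL2 n M)
    (ContinuousLinearMap.pi (fun i : t => innerSL ℂ (w i)))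
    (fun f => sub_nonneg.1 (gradNormSq_eq f ▸ gradNormSq_nonneg f)) hK0
    (fun f => by simpa only [gradNormSq_eq] using hK f) (kerLaplacian n M)ᗮ
    (Submodule.isClosed_orthogonal _) fun f hf hf0 => inner_self_eq_zero.1
      (hf f (mem_kerLaplacian_of_gradNormSq_eq_zero ((gradNormSq_eq f).trans hf0)))
  exact ⟨C, hC, fun f hf => by simpa only [gradNormSq_eq] using h f hf⟩

end Sobolev

/-! ### Averages in time -/

section Average

variable {E : Type*} [NormedAddCommGroup E] [NormedSpace ℝ E]

/-- The average of `w` on the interval between `t` and `t + h`. -/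
noncomputable def timeAverage (h : ℝ) (w : ℝ → E) (t : ℝ) : E := h⁻¹ • ∫ s in t..t + h, w s

theorem timeAverage_eq_of_hasDerivAt [CompleteSpace E] {w w' : ℝ → E} (hw' : Continuous w')
    (hw : ∀ t, HasDerivAt w (w' t) t) (h t : ℝ) :
    timeAverage h w' t = h⁻¹ • (w (t + h) - w t) := by
  rw [timeAverage, intervalIntegral.integral_eq_sub_of_hasDerivAt (fun s _ => hw s)
    (hw'.intervalIntegrable _ _)]

theorem map_timeAverage {F : Type*} [CompleteSpace E]
    [NormedAddCommGroup F] [NormedSpace ℝ F] [CompleteSpace F] (A : E →L[ℝ] F) {w : ℝ → E}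
    (hw : Continuous w) (h t : ℝ) : A (timeAverage h w t) = timeAverage h (fun s => A (w s)) t := by
  rw [timeAverage, timeAverage, map_smul,
    ← A.intervalIntegral_comp_comm (hw.intervalIntegrable _ _)]

theorem hasDerivAt_timeAverage [CompleteSpace E] {w : ℝ → E} (hw : Continuous w) (h t : ℝ) :
    HasDerivAt (timeAverage h w) (h⁻¹ • (w (t + h) - w t)) t := by
  have hI : ∀ x, HasDerivAt (fun y => ∫ s in (0 : ℝ)..y, w s) (w x) x := fun x =>
    intervalIntegral.integral_hasDerivAt_right (hw.intervalIntegrable _ _)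
      (hw.stronglyMeasurableAtFilter _ _) hw.continuousAt
  have h1 : timeAverage h w =
      fun t => h⁻¹ • ((∫ s in (0 : ℝ)..t + h, w s) - ∫ s in (0 : ℝ)..t, w s) := by
    funext t
    rw [timeAverage, intervalIntegral.integral_interval_sub_left
      (hw.intervalIntegrable _ _) (hw.intervalIntegrable _ _)]
  rw [h1]
  exact (((hI (t + h)).comp_add_const t h).sub (hI t)).const_smul h⁻¹

theorem continuous_timeAverage [CompleteSpace E] {w : ℝ → E} (hw : Continuous w) (h : ℝ) :
    Continuous (timeAverage h w) :=
  continuous_iff_continuousAt.2 fun t => (hasDerivAt_timeAverage hw h t).continuousAt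

theorem tendsto_timeAverage [CompleteSpace E] {w : ℝ → E} (hw : Continuous w) (t : ℝ) :
    Filter.Tendsto (fun h => timeAverage h w t) (nhdsWithin 0 (Set.Ioi 0)) (nhds (w t)) := by
  have hI : HasDerivAt (fun y => ∫ s in t..y, w s) (w t) t :=
    intervalIntegral.integral_hasDerivAt_right (hw.intervalIntegrable _ _)
      (hw.stronglyMeasurableAtFilter _ _) hw.continuousAt
  have := hI.tendsto_slope_zero_right
  simpa [timeAverage] using this

theorem norm_timeAverage_le {w : ℝ → E} {h t K : ℝ} (hh : 0 < h)
    (hK : ∀ s ∈ Set.Icc t (t + h), ‖w s‖ ≤ K) : ‖timeAverage h w t‖ ≤ K := by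
  have h1 : ‖∫ s in t..t + h, w s‖ ≤ K * |t + h - t| := by
    refine intervalIntegral.norm_integral_le_of_norm_le_const fun s hs => hK s ?_
    rw [Set.uIoc_of_le (by linarith)] at hs
    exact Set.Ioc_subset_Icc_self hs
  rw [timeAverage, norm_smul, norm_inv, Real.norm_of_nonneg hh.le, inv_mul_le_iff₀ hh]
  rwa [add_sub_cancel_left, abs_of_pos hh, mul_comm] at h1

end Average

/-! ### Weak solutions of abstract wave equations -/

section Abstract

variable {H L : Type*} [NormedAddCommGroup H] [InnerProductSpace ℝ H]
  [NormedAddCommGroup L] [InnerProductSpace ℝ L]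

/-- `u` is a weak solution of `u'' + A u = F`, where `v` is the derivative of `u` in the large space
`L`, into which `T` maps the small space `H`, and `A` is the operator of the quadratic form
`‖f‖² - ‖T f‖²`. -/
structure IsAbstractSolution (T : H →L[ℝ] L) (u : ℝ → H) (v F : ℝ → L) : Prop where
  continuous : Continuous u
  continuous_deriv : Continuous v
  continuous_source : Continuous F
  hasDerivAt : ∀ t, HasDerivAt (fun s => T (u s)) (v t) t
  weak_equation : ∀ φ t, HasDerivAt (fun s => inner ℝ (T φ) (v s))
    (-(inner ℝ φ (u t) - inner ℝ (T φ) (T (u t))) + inner ℝ (T φ) (F t)) t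

/-- The energy of `u`, where `v` stands for the derivative of `u`. -/
noncomputable def abstractEnergy (T : H →L[ℝ] L) (u : ℝ → H) (v : ℝ → L) (t : ℝ) : ℝ :=
  (‖u t‖ ^ 2 - ‖T (u t)‖ ^ 2 + ‖v t‖ ^ 2) / 2

namespace IsAbstractSolution

variable {T : H →L[ℝ] L} {u : ℝ → H} {v F : ℝ → L}

theorem inner_timeAverage [CompleteSpace H] [CompleteSpace L] (hs : IsAbstractSolution T u v F)
    (φ : H) (h t : ℝ) :
    inner ℝ (T φ) (h⁻¹ • (v (t + h) - v t)) =
      -(inner ℝ φ (timeAverage h u t) - inner ℝ (T φ) (T (timeAverage h u t))) +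
        inner ℝ (T φ) (timeAverage h F t) := by
  have hu := hs.continuous
  have hF := hs.continuous_source
  have h1 := timeAverage_eq_of_hasDerivAt (w := fun s => inner ℝ (T φ) (v s))
    (w' := fun t => -(inner ℝ φ (u t) - inner ℝ (T φ) (T (u t))) + inner ℝ (T φ) (F t))
    (by fun_prop) (hs.weak_equation φ) h t
  have h2 := map_timeAverage (innerSL ℝ (T φ)) hF h t
  have h3 := map_timeAverage
    (innerSL ℝ φ - (innerSL ℝ (T φ)).comp T) hu h t
  simp only [innerSL_apply_apply, sub_apply, ContinuousLinearMap.comp_apply]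
    at h2 h3
  rw [h3, h2, inner_smul_right, inner_sub_right, ← smul_eq_mul, ← h1]
  simp only [timeAverage]
  rw [intervalIntegral.integral_add, intervalIntegral.integral_neg, smul_add, smul_neg]
  all_goals exact Continuous.intervalIntegrable (by fun_prop) _ _

/-- The averages in time of a weak solution are regular enough to be used as test functions. -/
theorem hasDerivAt_energy_timeAverage [CompleteSpace H] [CompleteSpace L]
    (hs : IsAbstractSolution T u v F) (h t : ℝ) :
    HasDerivAt (abstractEnergy T (timeAverage h u) (timeAverage h v))
      (inner ℝ (timeAverage h v t) (timeAverage h F t)) t := by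
  have h1 := hasDerivAt_timeAverage hs.continuous h t
  have h2 := hasDerivAt_timeAverage hs.continuous_deriv h t
  have h3 := T.hasFDerivAt.comp_hasDerivAt t h1
  have h4 := (((h1.norm_sq).sub h3.norm_sq).add h2.norm_sq).div_const 2
  have hw : T (h⁻¹ • (u (t + h) - u t)) = timeAverage h v t := by
    rw [timeAverage_eq_of_hasDerivAt hs.continuous_deriv hs.hasDerivAt, map_smul, map_sub]
  have h5 := hs.inner_timeAverage (h⁻¹ • (u (t + h) - u t)) h t
  refine h4.congr_deriv ?_
  rw [hw] at h5 ⊢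
  rw [h5, real_inner_comm (h⁻¹ • (u (t + h) - u t)), Function.comp_apply,
    real_inner_comm (timeAverage h v t) (T _)]
  ring

/-- The energy identity. It is immediate for averages in time over intervals of length `h`, and
`h → 0`. -/
theorem energy_sub_energy [CompleteSpace H] [CompleteSpace L] (hs : IsAbstractSolution T u v F)
    {a b : ℝ} (hab : a ≤ b) :
    abstractEnergy T u v b - abstractEnergy T u v a = ∫ t in a..b, inner ℝ (v t) (F t) := by
  have hu := hs.continuous
  have hv := hs.continuous_deriv
  have hF := hs.continuous_source
  have hE : ∀ t, Filter.Tendsto (fun h => abstractEnergy T (timeAverage h u) (timeAverage h v) t)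
      (nhdsWithin 0 (Set.Ioi 0)) (nhds (abstractEnergy T u v t)) := by
    intro t
    have h1 := tendsto_timeAverage hu t
    have h2 := tendsto_timeAverage hv t
    exact (((h1.norm.pow 2).sub ((((T.continuous.tendsto _).comp h1).norm).pow 2)).add
      (h2.norm.pow 2)).div_const 2
  have hdiff : ∀ h, abstractEnergy T (timeAverage h u) (timeAverage h v) b -
      abstractEnergy T (timeAverage h u) (timeAverage h v) a =
      ∫ t in a..b, inner ℝ (timeAverage h v t) (timeAverage h F t) := fun h =>
    (intervalIntegral.integral_eq_sub_of_hasDerivAt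
      (fun t _ => hs.hasDerivAt_energy_timeAverage h t)
      (((continuous_timeAverage hv h).inner (continuous_timeAverage hF h)).intervalIntegrable
        _ _)).symm
  obtain ⟨K₁, hK₁⟩ := (isCompact_Icc (a := a) (b := b + 1)).exists_bound_of_continuousOn
    hv.continuousOn
  obtain ⟨K₂, hK₂⟩ := (isCompact_Icc (a := a) (b := b + 1)).exists_bound_of_continuousOn
    hF.continuousOn
  have hlim : Filter.Tendsto
      (fun h => ∫ t in a..b, inner ℝ (timeAverage h v t) (timeAverage h F t))
      (nhdsWithin 0 (Set.Ioi 0)) (nhds (∫ t in a..b, inner ℝ (v t) (F t))) := by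
    refine intervalIntegral.tendsto_integral_filter_of_dominated_convergence (fun _ => K₁ * K₂)
      (Filter.Eventually.of_forall fun h => ?_) ?_ intervalIntegrable_const
      (Filter.Eventually.of_forall fun t _ =>
        (tendsto_timeAverage hv t).inner (tendsto_timeAverage hF t))
    · exact ((continuous_timeAverage hv h).inner
        (continuous_timeAverage hF h)).aestronglyMeasurable
    · filter_upwards [Ioo_mem_nhdsGT (zero_lt_one (α := ℝ))] with h hh
      refine Filter.Eventually.of_forall fun t ht => ?_
      rw [Set.uIoc_of_le hab] at ht
      have hsub : Set.Icc t (t + h) ⊆ Set.Icc a (b + 1) :=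
        Set.Icc_subset_Icc ht.1.le (by linarith [ht.2, hh.2])
      have h1 := norm_timeAverage_le hh.1 fun s hs => hK₁ s (hsub hs)
      have h2 := norm_timeAverage_le hh.1 fun s hs => hK₂ s (hsub hs)
      exact (norm_inner_le_norm _ _).trans
        (mul_le_mul h1 h2 (norm_nonneg _) ((norm_nonneg _).trans h1))
  refine tendsto_nhds_unique ((hE b).sub (hE a)) ?_
  simpa only [hdiff] using hlim

theorem antitone_energy [CompleteSpace H] [CompleteSpace L] (hs : IsAbstractSolution T u v F)
    (hdiss : ∀ t, inner ℝ (v t) (F t) ≤ 0) : Antitone (abstractEnergy T u v) := by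
  intro a b hab
  have h := hs.energy_sub_energy hab
  have h1 : ∫ t in a..b, inner ℝ (v t) (F t) ≤ 0 := by
    have := intervalIntegral.integral_nonneg hab (μ := volume)
      (f := fun t => -inner ℝ (v t) (F t)) fun t _ => neg_nonneg.2 (hdiss t)
    rw [intervalIntegral.integral_neg] at this
    linarith
  linarith

/-- The derivative of `⟨u, u'⟩`, where the first factor is projected by `Q`. The weak equation is
used at the fixed test function `R (u t)`. -/
theorem hasDerivAt_inner (hs : IsAbstractSolution T u v F) (Q : L →L[ℝ] L) (R : H → H)
    (hTR : ∀ f, T (R f) = Q (T f))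
    (hR : ∀ f, inner ℝ (R f) f - inner ℝ (T (R f)) (T f) = ‖f‖ ^ 2 - ‖T f‖ ^ 2) (t : ℝ) :
    HasDerivAt (fun s => inner ℝ (Q (T (u s))) (v s))
      (inner ℝ (Q (v t)) (v t) - (‖u t‖ ^ 2 - ‖T (u t)‖ ^ 2) +
        inner ℝ (Q (T (u t))) (F t)) t := by
  have h1 : HasDerivAt (fun s => Q (T (u s))) (Q (v t)) t :=
    Q.hasFDerivAt.comp_hasDerivAt t (hs.hasDerivAt t)
  have h2 : HasDerivAt (fun s => inner ℝ (Q (T (u s)) - Q (T (u t))) (v s))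
      (inner ℝ (Q (v t)) (v t)) t := by
    rw [hasDerivAt_iff_tendsto_slope]
    have h3 := Filter.Tendsto.inner (𝕜 := ℝ) (hasDerivAt_iff_tendsto_slope.1 h1)
      ((hs.continuous_deriv.tendsto t).mono_left (nhdsWithin_le_nhds (s := {t}ᶜ)))
    refine h3.congr fun s => ?_
    simp [slope_def_module, inner_smul_left, inner_sub_left]
  have h4 := hs.weak_equation (R (u t)) t
  rw [hTR, ← hTR, hR, hTR] at h4
  refine ((h2.add h4).congr_deriv (by ring)).congr_of_eventuallyEq
    (Filter.Eventually.of_forall fun s => ?_)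
  simp [inner_sub_left]

end IsAbstractSolution

end Abstract

theorem exists_le_integral_of_continuous {f : ℝ → ℝ} (hf : Continuous f) (c : ℝ) :
    ∃ a ∈ Set.Icc c (c + 1), f a ≤ ∫ t in c..c + 1, f t := by
  obtain ⟨a, ha, hmin⟩ := (isCompact_Icc (a := c) (b := c + 1)).exists_isMinOn
    ⟨c, by simp⟩ hf.continuousOn
  refine ⟨a, ha, ?_⟩
  have := intervalIntegral.integral_mono_on (μ := volume) (by linarith : c ≤ c + 1)
    (intervalIntegrable_const (c := f a)) (hf.intervalIntegrable _ _) fun t ht => hmin ht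
  simpa using this

/-! ### Observability for abstract damped waves -/

/-- The derivative of `⟨Q T u, u'⟩` is, up to the damping term, `‖Q u'‖² - ‖∇ u‖²`. It is integrated
between a time `a` of `[t₁, t₁ + 1]` and a time `b` of `[t₂ - 1, t₂]`, at which `‖u'‖²` is at most its
mean value over the respective interval. -/
theorem IsAbstractSolution.observability {H L : Type*} [NormedAddCommGroup H]
    [InnerProductSpace ℝ H] [CompleteSpace H] [NormedAddCommGroup L] [InnerProductSpace ℝ L]
    [CompleteSpace L] {T : H →L[ℝ] L} {u : ℝ → H} {v F : ℝ → L}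
    (hs : IsAbstractSolution T u v F) (hdiss : ∀ t, inner ℝ (v t) (F t) ≤ 0)
    {β B C : ℝ} (hF : ∀ t, ‖F t‖ ≤ β * ‖v t‖) (hB : 3 ≤ B) (hβB : β ^ 2 ≤ B)
    (Q : L →L[ℝ] L) (R : H → H) (hTR : ∀ f, T (R f) = Q (T f))
    (hR : ∀ f, inner ℝ (R f) f - inner ℝ (T (R f)) (T f) = ‖f‖ ^ 2 - ‖T f‖ ^ 2)
    (hQ : ∀ x, ‖Q x‖ ≤ ‖x‖) (hC : ∀ f, ‖Q (T f)‖ ^ 2 ≤ C ^ 2 * (‖f‖ ^ 2 - ‖T f‖ ^ 2))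
    {t₁ t₂ ε : ℝ} (ht : 2 < t₂ - t₁) (hε : 0 < ε) (hε' : ε < 1 / 2) :
    ε / (2 * B) * (t₂ - t₁ - 2) * abstractEnergy T u v t₂
        - C ^ 2 * ε ^ 2 / (2 * B) * (t₂ - t₁) * abstractEnergy T u v t₁
      ≤ ∫ t in t₁..t₂, ‖v t‖ ^ 2 := by
  have hanti := hs.antitone_energy hdiss
  have hv := hs.continuous_deriv
  have hu := hs.continuous
  have hFc := hs.continuous_source
  have hv2 : Continuous fun t => ‖v t‖ ^ 2 := hv.norm.pow 2
  have hint : ∀ a b, IntervalIntegrable (fun t => ‖v t‖ ^ 2) volume a b :=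
    fun a b => hv2.intervalIntegrable a b
  set e := abstractEnergy T u v with he
  set y : ℝ → L := fun t => Q (T (u t)) with hy
  set g : ℝ → ℝ := fun t => inner ℝ (y t) (v t) with hg
  have hq : ∀ t, ‖u t‖ ^ 2 - ‖T (u t)‖ ^ 2 = 2 * e t - ‖v t‖ ^ 2 := fun t => by
    simp only [he, abstractEnergy]; ring
  have hye : ∀ t, t₁ ≤ t → ‖y t‖ ^ 2 ≤ 2 * C ^ 2 * e t₁ := by
    intro t ht
    have h1 := hC (u t)
    rw [hq] at h1
    have h2 := mul_le_mul_of_nonneg_left (hanti ht) (sq_nonneg C)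
    have h3 : 0 ≤ C ^ 2 * ‖v t‖ ^ 2 := by positivity
    change ‖y t‖ ^ 2 ≤ _ at h1
    linarith
  have he₁ : 0 ≤ C ^ 2 * e t₁ := by linarith [hye t₁ le_rfl, sq_nonneg ‖y t₁‖]
  -- Young's inequality with weight `ε`
  have hyoung : ∀ a b : ℝ, a * b ≤ ε / 2 * a ^ 2 + b ^ 2 / (2 * ε) := by
    intro a b
    have h1 : ε / 2 * a ^ 2 + b ^ 2 / (2 * ε) - a * b = (ε * a - b) ^ 2 / (2 * ε) := by
      field_simp; ring
    have h2 : 0 ≤ (ε * a - b) ^ 2 / (2 * ε) := by positivity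
    linarith
  have hgbound : ∀ t, t₁ ≤ t → |g t| ≤ ε * (C ^ 2 * e t₁) + ‖v t‖ ^ 2 / (2 * ε) := by
    intro t ht
    have h1 := abs_real_inner_le_norm (y t) (v t)
    have h2 := hyoung ‖y t‖ ‖v t‖
    have h3 := mul_le_mul_of_nonneg_left (hye t ht) (half_pos hε).le
    linarith
  set g' : ℝ → ℝ := fun t => inner ℝ (Q (v t)) (v t) - (‖u t‖ ^ 2 - ‖T (u t)‖ ^ 2) +
    inner ℝ (Q (T (u t))) (F t) with hg'
  have hgd : ∀ t, HasDerivAt g (g' t) t := hs.hasDerivAt_inner Q R hTR hR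
  have hg'c : Continuous g' := by fun_prop
  have hkey : ∀ t, t₁ ≤ t → t ≤ t₂ → 2 * e t₂ ≤
      (2 + β ^ 2 / (2 * ε)) * ‖v t‖ ^ 2 + ε * (C ^ 2 * e t₁) - g' t := by
    intro t ht ht'
    have h1 : inner ℝ (Q (v t)) (v t) ≤ ‖v t‖ ^ 2 := by
      refine (real_inner_le_norm _ _).trans ?_
      rw [pow_two]
      exact mul_le_mul_of_nonneg_right (hQ _) (norm_nonneg _)
    have h2 : inner ℝ (y t) (F t) ≤ ‖y t‖ * (β * ‖v t‖) :=
      (real_inner_le_norm _ _).trans (mul_le_mul_of_nonneg_left (hF t) (norm_nonneg _))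
    have h3 := hyoung ‖y t‖ (β * ‖v t‖)
    have h4 := mul_le_mul_of_nonneg_left (hye t ht) (half_pos hε).le
    have h5 : (β * ‖v t‖) ^ 2 / (2 * ε) = β ^ 2 / (2 * ε) * ‖v t‖ ^ 2 := by ring
    have h6 := hanti ht'
    have h7 : g' t = inner ℝ (Q (v t)) (v t) - (2 * e t - ‖v t‖ ^ 2) + inner ℝ (y t) (F t) := by
      simp only [hg', hq, hy]
    rw [h7]
    linarith
  obtain ⟨a, ha, hva⟩ := exists_le_integral_of_continuous hv2 t₁
  obtain ⟨b, hb, hvb⟩ := exists_le_integral_of_continuous hv2 (t₂ - 1)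
  rw [sub_add_cancel] at hb hvb
  have hab : a ≤ b := by linarith [ha.2, hb.1]
  set J := ∫ t in t₁..t₂, ‖v t‖ ^ 2 with hJ
  have hnn : ∀ c d, c ≤ d → 0 ≤ ∫ t in c..d, ‖v t‖ ^ 2 := fun c d hcd =>
    intervalIntegral.integral_nonneg hcd fun t _ => sq_nonneg _
  have hJends : ‖v a‖ ^ 2 + ‖v b‖ ^ 2 ≤ J := by
    have h1 := intervalIntegral.integral_add_adjacent_intervals (hint t₁ (t₁ + 1))
      (hint (t₁ + 1) (t₂ - 1))
    have h2 := intervalIntegral.integral_add_adjacent_intervals (hint t₁ (t₂ - 1))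
      (hint (t₂ - 1) t₂)
    have h3 := hnn (t₁ + 1) (t₂ - 1) (by linarith)
    linarith
  have hJmid : ∫ t in a..b, ‖v t‖ ^ 2 ≤ J := by
    have h1 := intervalIntegral.integral_add_adjacent_intervals (hint t₁ a) (hint a b)
    have h2 := intervalIntegral.integral_add_adjacent_intervals (hint t₁ b) (hint b t₂)
    have h3 := hnn t₁ a ha.1
    have h4 := hnn b t₂ hb.2
    linarith
  have hI : (b - a) * (2 * e t₂) ≤ (2 + β ^ 2 / (2 * ε)) * (∫ t in a..b, ‖v t‖ ^ 2) +
      (b - a) * (ε * (C ^ 2 * e t₁)) - (g b - g a) := by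
    have h1 : ∫ t in a..b, g' t = g b - g a :=
      intervalIntegral.integral_eq_sub_of_hasDerivAt (fun t _ => hgd t)
        (hg'c.intervalIntegrable _ _)
    have h2 := intervalIntegral.integral_mono_on (μ := volume) hab
      (intervalIntegrable_const (c := 2 * e t₂))
      ((((hint a b).const_mul (2 + β ^ 2 / (2 * ε))).add
        (intervalIntegrable_const (c := ε * (C ^ 2 * e t₁)))).sub
        (hg'c.intervalIntegrable a b)) fun t ht =>
      hkey t (ha.1.trans ht.1) (ht.2.trans hb.2)
    rw [intervalIntegral.integral_const, smul_eq_mul,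
      intervalIntegral.integral_sub (((hint a b).const_mul _).add intervalIntegrable_const)
        (hg'c.intervalIntegrable a b),
      intervalIntegral.integral_add ((hint a b).const_mul _) intervalIntegrable_const,
      intervalIntegral.integral_const_mul, intervalIntegral.integral_const, smul_eq_mul, h1] at h2
    exact h2
  have hJ0 : 0 ≤ J := hnn t₁ t₂ (by linarith)
  have hmain : (t₂ - t₁ - 2) * (2 * e t₂) ≤
      (2 + (β ^ 2 + 1) / (2 * ε)) * J + 2 * (t₂ - t₁) * (ε * (C ^ 2 * e t₁)) := by
    have hga := hgbound a ha.1
    have hgb := hgbound b (ha.1.trans hab)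
    have hga' := le_abs_self (g a)
    have hgb' := neg_abs_le (g b)
    have h1 : (2 + β ^ 2 / (2 * ε)) * (∫ t in a..b, ‖v t‖ ^ 2) ≤ (2 + β ^ 2 / (2 * ε)) * J := by
      gcongr
    have h2 : ‖v a‖ ^ 2 / (2 * ε) + ‖v b‖ ^ 2 / (2 * ε) ≤ J / (2 * ε) := by
      rw [← add_div]; gcongr
    have h3 : 0 ≤ ε * (C ^ 2 * e t₁) := by positivity
    have h4 : (b - a + 2) * (ε * (C ^ 2 * e t₁)) ≤ 2 * (t₂ - t₁) * (ε * (C ^ 2 * e t₁)) := by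
      apply mul_le_mul_of_nonneg_right _ h3
      linarith [ha.1, hb.2]
    have h5 : (2 + (β ^ 2 + 1) / (2 * ε)) * J = (2 + β ^ 2 / (2 * ε)) * J + J / (2 * ε) := by ring
    -- the sign of the quadratic form, hence of the energy, is not known in this generality
    by_cases he2 : 0 ≤ e t₂
    · have h6 : (t₂ - t₁ - 2) * (2 * e t₂) ≤ (b - a) * (2 * e t₂) := by
        apply mul_le_mul_of_nonneg_right _ (by linarith)
        linarith [ha.2, hb.1]
      linarith
    · have h7 : (t₂ - t₁ - 2) * (2 * e t₂) ≤ 0 :=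
        mul_nonpos_of_nonneg_of_nonpos (by linarith) (by linarith)
      have h8 : 0 ≤ 2 * (t₂ - t₁) * (ε * (C ^ 2 * e t₁)) := mul_nonneg (by linarith) h3
      have h9 : 0 ≤ (2 + (β ^ 2 + 1) / (2 * ε)) * J := by positivity
      linarith
  have hB0 : 0 < B := by linarith
  have hscale := mul_le_mul_of_nonneg_left hmain (by positivity : 0 ≤ ε / (4 * B))
  have hcoef : ε / (4 * B) * (2 + (β ^ 2 + 1) / (2 * ε)) ≤ 1 := by
    have h1 : ε / (4 * B) * (2 + (β ^ 2 + 1) / (2 * ε)) = (4 * ε + (β ^ 2 + 1)) / (8 * B) := by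
      field_simp; ring
    rw [h1, div_le_one (by positivity)]
    linarith
  have hcJ := mul_le_mul_of_nonneg_right hcoef hJ0
  have e1 : ε / (2 * B) * (t₂ - t₁ - 2) * e t₂ =
      ε / (4 * B) * ((t₂ - t₁ - 2) * (2 * e t₂)) := by
    field_simp; ring
  have e2 : C ^ 2 * ε ^ 2 / (2 * B) * (t₂ - t₁) * e t₁ =
      ε / (4 * B) * (2 * (t₂ - t₁) * (ε * (C ^ 2 * e t₁))) := by
    field_simp; ring
  rw [e1, e2]
  linarith

/-- The complex version of the observability inequality, for a Poincaré inequality on the orthogonal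
complement of a subspace `N` of the kernel of the form `⟪f, h⟫ - ⟪T f, T h⟫`. The solution itself need
not be orthogonal to `N`: its component in `N` is projected out. -/
theorem observability_of_orthogonal {H L : Type*} [NormedAddCommGroup H]
    [InnerProductSpace ℂ H] [CompleteSpace H] [NormedAddCommGroup L] [InnerProductSpace ℂ L]
    [CompleteSpace L] (T : H →L[ℂ] L) {u : ℝ → H} {v F : ℝ → L}
    (hu : Continuous u) (hv : Continuous v) (hFc : Continuous F)
    (hd : ∀ t, HasDerivAt (fun s => T (u s)) (v t) t)
    (hw : ∀ φ t, HasDerivAt (fun s => inner ℂ (T φ) (v s))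
      (-(inner ℂ φ (u t) - inner ℂ (T φ) (T (u t))) + inner ℂ (T φ) (F t)) t)
    (hdiss : ∀ t, (inner ℂ (v t) (F t)).re ≤ 0)
    {β B C : ℝ} (hF : ∀ t, ‖F t‖ ≤ β * ‖v t‖) (hB : 3 ≤ B) (hβB : β ^ 2 ≤ B)
    (N : Submodule ℂ H) (hNc : IsClosed (N : Set H))
    (hN : ∀ h ∈ N, ∀ φ, inner ℂ φ h = inner ℂ (T φ) (T h))
    (hC : ∀ f ∈ Nᗮ, ‖T f‖ ^ 2 ≤ C ^ 2 * (‖f‖ ^ 2 - ‖T f‖ ^ 2))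
    {t₁ t₂ ε : ℝ} (ht : 2 < t₂ - t₁) (hε : 0 < ε) (hε' : ε < 1 / 2) :
    ε / (2 * B) * (t₂ - t₁ - 2) * ((‖u t₂‖ ^ 2 - ‖T (u t₂)‖ ^ 2 + ‖v t₂‖ ^ 2) / 2)
        - C ^ 2 * ε ^ 2 / (2 * B) * (t₂ - t₁) *
          ((‖u t₁‖ ^ 2 - ‖T (u t₁)‖ ^ 2 + ‖v t₁‖ ^ 2) / 2)
      ≤ ∫ t in t₁..t₂, ‖v t‖ ^ 2 := by
  let : InnerProductSpace ℝ H := InnerProductSpace.complexToReal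
  let : InnerProductSpace ℝ L := InnerProductSpace.complexToReal
  have : CompleteSpace N := hNc.completeSpace_coe
  set K : Submodule ℂ L := (N.map T.toLinearMap).topologicalClosure with hK
  have : CompleteSpace K := (Submodule.isClosed_topologicalClosure _).completeSpace_coe
  have hN' : ∀ h ∈ N, ∀ φ, inner ℂ h φ = inner ℂ (T h) (T φ) := fun h hh φ => by
    rw [← inner_conj_symm, hN h hh φ, inner_conj_symm]
  have hproj : ∀ f, K.starProjection (T f) = T (N.starProjection f) := by
    intro f
    refine Submodule.eq_starProjection_of_mem_orthogonal
      (Submodule.le_topologicalClosure _ ⟨_, N.starProjection_apply_mem f, rfl⟩) ?_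
    rw [hK, Submodule.orthogonal_closure]
    rintro _ ⟨h, hh, rfl⟩
    change inner ℂ (T h) (T f - T (N.starProjection f)) = 0
    rw [← map_sub, ← hN' h hh]
    exact N.sub_starProjection_mem_orthogonal f h hh
  have hs : IsAbstractSolution (T.restrictScalars ℝ) u v F := by
    refine ⟨hu, hv, hFc, hd, fun φ t => ?_⟩
    have := Complex.reCLM.hasFDerivAt.comp_hasDerivAt t (hw φ t)
    refine this.congr_deriv ?_
    rw [map_add, map_neg, map_sub]
    rfl
  have hform : ∀ f, inner ℂ (f - N.starProjection f) f -
      inner ℂ (T (f - N.starProjection f)) (T f) = inner ℂ f f - inner ℂ (T f) (T f) := by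
    intro f
    rw [map_sub, inner_sub_left, inner_sub_left, hN' _ (N.starProjection_apply_mem f) f]
    ring
  have hre : ∀ f, (inner ℂ f f - inner ℂ (T f) (T f)).re = ‖f‖ ^ 2 - ‖T f‖ ^ 2 := by
    intro f
    rw [Complex.sub_re, @norm_sq_eq_re_inner ℂ, @norm_sq_eq_re_inner ℂ]
    rfl
  refine hs.observability (fun t => by rw [real_inner_eq_re_inner ℂ]; exact hdiss t) hF hB hβB
    ((ContinuousLinearMap.id ℂ L - K.starProjection).restrictScalars ℝ)
    (fun f => f - N.starProjection f) (fun f => ?_) (fun f => ?_) (fun x => ?_) (fun f => ?_)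
    ht hε hε'
  · change T (f - N.starProjection f) = T f - K.starProjection (T f)
    rw [hproj, map_sub]
  · rw [real_inner_eq_re_inner ℂ, real_inner_eq_re_inner ℂ]
    change (inner ℂ (f - N.starProjection f) f).re -
      (inner ℂ (T (f - N.starProjection f)) (T f)).re = ‖f‖ ^ 2 - ‖T f‖ ^ 2
    rw [← Complex.sub_re, hform, hre]
  · change ‖x - K.starProjection x‖ ≤ ‖x‖
    rw [← Submodule.starProjection_orthogonal_val]
    exact Submodule.norm_starProjection_apply_le _ _
  · change ‖T f - K.starProjection (T f)‖ ^ 2 ≤ C ^ 2 * (‖f‖ ^ 2 - ‖T f‖ ^ 2)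
    rw [hproj, ← map_sub, ← hre f, ← hform f]
    refine (hC _ (N.sub_starProjection_mem_orthogonal f)).trans_eq ?_
    rw [← hre (f - _)]
    congr 2
    have h1 := hN _ (N.starProjection_apply_mem f) (f - N.starProjection f)
    conv_lhs => rw [map_sub T, inner_sub_right, inner_sub_right, ← map_sub T, h1]
    ring

/-! ### The damping term -/

section Multiplication

variable {α : Type*} [TopologicalSpace α] [MeasurableSpace α] [OpensMeasurableSpace α]
  {μ : Measure α}

theorem memLp_boundedContinuous_mul (w : α →ᵇ ℝ) (g : Lp ℂ 2 μ) :
    MemLp (fun x => (w x : ℂ) * g x) 2 μ := by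
  refine MemLp.of_le_mul (c := ‖w‖) (Lp.memLp g) ?_ (Filter.Eventually.of_forall fun x => ?_)
  · exact (Complex.continuous_ofReal.comp w.continuous).aestronglyMeasurable.mul
      (Lp.memLp g).aestronglyMeasurable
  · rw [norm_mul, Complex.norm_real]
    gcongr
    exact w.norm_coe_le_norm x

/-- The product of a bounded continuous function and an element of `L²`. -/
noncomputable def mulLp (w : α →ᵇ ℝ) (g : Lp ℂ 2 μ) : Lp ℂ 2 μ :=
  (memLp_boundedContinuous_mul w g).toLp _

theorem coeFn_mulLp (w : α →ᵇ ℝ) (g : Lp ℂ 2 μ) : mulLp w g =ᵐ[μ] fun x => (w x : ℂ) * g x :=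
  MemLp.coeFn_toLp _

theorem norm_mulLp_le (w : α →ᵇ ℝ) (g : Lp ℂ 2 μ) : ‖mulLp w g‖ ≤ ‖w‖ * ‖g‖ := by
  refine Lp.norm_le_mul_norm_of_ae_le_mul ?_
  filter_upwards [coeFn_mulLp w g] with x hx
  rw [hx, norm_mul, Complex.norm_real]
  gcongr
  exact w.norm_coe_le_norm x

theorem mulLp_sub_mulLp (w w₀ : α →ᵇ ℝ) (g g₀ : Lp ℂ 2 μ) :
    mulLp w g - mulLp w₀ g₀ = mulLp w (g - g₀) + mulLp (w - w₀) g₀ := by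
  refine Lp.ext ?_
  filter_upwards [Lp.coeFn_sub (mulLp w g) (mulLp w₀ g₀),
    Lp.coeFn_add (mulLp w (g - g₀)) (mulLp (w - w₀) g₀), coeFn_mulLp w g, coeFn_mulLp w₀ g₀,
    coeFn_mulLp w (g - g₀), coeFn_mulLp (w - w₀) g₀, Lp.coeFn_sub g g₀] with x h1 h2 h3 h4 h5 h6 h7
  rw [h1, h2, Pi.sub_apply, Pi.add_apply, h3, h4, h5, h6, h7, Pi.sub_apply,
    BoundedContinuousFunction.sub_apply, Complex.ofReal_sub]
  ring

theorem inner_mulLp (w : α →ᵇ ℝ) (f g : Lp ℂ 2 μ) :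
    inner ℂ f (mulLp w g) = ∫ x, (w x : ℂ) * (conj (f x) * g x) ∂μ := by
  rw [L2.inner_def]
  refine integral_congr_ae ?_
  filter_upwards [coeFn_mulLp w g] with x hx
  rw [hx, RCLike.inner_apply]
  ring

theorem re_inner_mulLp_nonneg {w : α →ᵇ ℝ} (hw : ∀ x, 0 ≤ w x) (g : Lp ℂ 2 μ) :
    0 ≤ (inner ℂ g (mulLp w g)).re := by
  have h : ∀ x, (w x : ℂ) * (conj (g x) * g x) = ((w x * ‖g x‖ ^ 2 : ℝ) : ℂ) := fun x => by
    rw [Complex.conj_mul']; push_cast; rfl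
  rw [inner_mulLp]
  simp only [h]
  rw [integral_complex_ofReal, Complex.ofReal_re]
  exact integral_nonneg fun x => mul_nonneg (hw x) (sq_nonneg _)

theorem continuous_mulLp {w : ℝ → α →ᵇ ℝ} (hw : Continuous w) {g : ℝ → Lp ℂ 2 μ}
    (hg : Continuous g) : Continuous fun t => mulLp (w t) (g t) := by
  refine continuous_iff_continuousAt.2 fun t₀ => tendsto_iff_norm_sub_tendsto_zero.2 ?_
  have hlim : Filter.Tendsto (fun t => ‖w t‖ * ‖g t - g t₀‖ + ‖w t - w t₀‖ * ‖g t₀‖) (nhds t₀)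
      (nhds 0) := by
    have : Continuous fun t => ‖w t‖ * ‖g t - g t₀‖ + ‖w t - w t₀‖ * ‖g t₀‖ := by fun_prop
    simpa using this.tendsto t₀
  refine squeeze_zero (fun t => norm_nonneg _) (fun t => ?_) hlim
  rw [mulLp_sub_mulLp]
  exact (norm_add_le _ _).trans (add_le_add (norm_mulLp_le _ _) (norm_mulLp_le _ _))

end Multiplication

section TimeSlice

variable {M : Type*} [TopologicalSpace M]

/-- The function `W(·, t)`. -/
noncomputable def timeSlice (W : (M × ℝ) →ᵇ ℝ) (t : ℝ) : M →ᵇ ℝ :=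
  W.compContinuous ⟨fun x => (x, t), by fun_prop⟩

theorem norm_timeSlice_le (W : (M × ℝ) →ᵇ ℝ) (t : ℝ) : ‖timeSlice W t‖ ≤ ‖W‖ :=
  (BoundedContinuousFunction.norm_le (norm_nonneg _)).2 fun _ => W.norm_coe_le_norm _

/-- As `∂ₜ W` is bounded, `W(·, t)` depends continuously on `t` for the uniform norm. -/
theorem continuous_timeSlice (W W' : (M × ℝ) →ᵇ ℝ)
    (hW : ∀ (x : M) (t : ℝ), HasDerivAt (fun s => W (x, s)) (W' (x, t)) t) :
    Continuous (timeSlice W) := by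
  have h : LipschitzWith ‖W'‖₊ (timeSlice W) := by
    refine LipschitzWith.of_dist_le_mul fun s t => ?_
    rw [BoundedContinuousFunction.dist_le (by positivity)]
    intro x
    rw [dist_eq_norm, dist_eq_norm]
    exact convex_univ.norm_image_sub_le_of_norm_hasDerivWithin_le (f := fun s => W (x, s))
      (fun r _ => (hW x r).hasDerivWithinAt) (fun r _ => W'.norm_coe_le_norm _)
      (Set.mem_univ t) (Set.mem_univ s)
  exact h.continuous

end TimeSlice

/-! ### Conclusion -/

/-- Having a given derivative does not depend on the structure of real normed space, as this
structure is determined by the norm and the addition. -/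
theorem hasDerivAt_of_hasDerivAt_normedSpace {E : Type*} [NormedAddCommGroup E]
    [i₁ : NormedSpace ℝ E] {f : ℝ → E} {f' : E} {t : ℝ} (h : HasDerivAt f f' t)
    (i₂ : NormedSpace ℝ E) : HasDerivAt f f' t := by
  have h0 : i₁.toModule = i₂.toModule := by
    refine Module.ext' _ _ fun r x => ?_
    have c : ∀ i : NormedSpace ℝ E, ContinuousSMul ℝ E := fun i => inferInstance
    exact @map_real_smul E _ i₁.toModule _ (c i₁) E _ i₂.toModule _ (c i₂) _ _ _ _
      (AddMonoidHom.id E) continuous_id r x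
  have h1 : i₁ = i₂ := by
    cases i₁; cases i₂; congr
  subst h1
  exact h

end DampedWave

open DampedWave
theorem proposition3 (n : ℕ) (M : Type*) [TopologicalSpace M] [T2Space M] [CompactSpace M]
    [ChartedSpace (EuclideanSpace ℝ (Fin n)) M] [IsManifold (𝓡 n) ∞ M]
    [RiemannianBundle (fun x : M => TangentSpace (𝓡 n) x)]
    [IsContMDiffRiemannianBundle (𝓡 n) ∞ (EuclideanSpace ℝ (Fin n))
      (fun x : M => TangentSpace (𝓡 n) x)]
    [MeasurableSpace M] [BorelSpace M] :
    (∃ C : ℝ, IsPoincareConstant n M C) ∧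
    ∀ C : ℝ, IsPoincareConstant n M C →
    ∀ W W' : (M × ℝ) →ᵇ ℝ, (∀ p, 0 ≤ W p) →
      (∀ (x : M) (t : ℝ), HasDerivAt (fun s => W (x, s)) (W' (x, t)) t) →
    ∀ u : ℝ → H1 n M, IsSolution W u →
      (WithLp.toLp 2 (u 0, timeDeriv u 0) : EnergySpace n M) ∈ (kerLaplacianProd n M)ᗮ →
    ∀ t₁ t₂ : ℝ, 2 < t₂ - t₁ → ∀ ε : ℝ, 0 < ε → ε < 1 / 2 →
      ε / (2 * max 3 (‖W‖ ^ 2)) * (t₂ - t₁ - 2) * energy u t₂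
          - C ^ 2 * ε ^ 2 / (2 * max 3 (‖W‖ ^ 2)) * (t₂ - t₁) * energy u t₁
        ≤ ∫ t in t₁..t₂, ‖timeDeriv u t‖ ^ 2 := by
  refine ⟨exists_isPoincareConstant n M, ?_⟩
  intro C hC W W' hW0 hW u hu _ t₁ t₂ ht ε hε hε'
  have hv : Continuous (timeDeriv u) := hu.contDiff.continuous_deriv le_rfl
  have hd : ∀ t, HasDerivAt (fun s => toL2 n M (u s)) (timeDeriv u t) t := fun t =>
    (hu.contDiff.differentiable one_ne_zero t).hasDerivAt
  have key := observability_of_orthogonal (toL2 n M) (u := u) (v := timeDeriv u)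
    (F := fun t => -mulLp (timeSlice W t) (timeDeriv u t)) (β := ‖W‖) (B := max 3 (‖W‖ ^ 2))
    (C := C) hu.continuous hv (continuous_mulLp (continuous_timeSlice W W' hW) hv).neg
    (fun t => hasDerivAt_of_hasDerivAt_normedSpace (hd t) _) (fun φ t => ?_) (fun t => ?_)
    (fun t => ?_) (le_max_left _ _) (le_max_right _ _) (kerLaplacian n M)
    (isClosed_kerLaplacian n M) (fun h hh φ => sub_eq_zero.1 (hh φ))
    (fun f hf => by simpa only [gradNormSq_eq] using hC.2 f hf) ht hε hε'
  · simpa only [energy, gradNormSq_eq] using key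
  · refine (hu.weak_equation φ t).congr_deriv ?_
    rw [inner_neg_right, inner_mulLp, dirichlet, sub_eq_add_neg]
    rfl
  · rw [inner_neg_right, Complex.neg_re, neg_nonpos]
    exact re_inner_mulLp_nonneg (w := timeSlice W t) (fun x => hW0 (x, t)) _
  · rw [norm_neg]
    exact (norm_mulLp_le _ _).trans
      (mul_le_mul_of_nonneg_right (norm_timeSlice_le W t) (norm_nonneg _))
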